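/- Let $S=\bigoplus_{i\ge 0}S_i$ be a commutative Noetherian $\mathbb N$-graded ring whose degree-zero component $S_0$ is local with residue field $\Bbbk$ (an $S$-algebra via $S\to S_0\to\Bbbk$). Let $M$ be a finitely generated $\mathbb Z$-graded $S$-module of finite projective dimension, with graded Betti numbers $\beta_{i,k}$: its minimal graded free resolution has terms $F_i=\bigoplus_k S(-k)^{\beta_{i,k}}$. The Betti table of $M$ has the entry $\beta_{c,\,r+c}$ in column $c$ and row $r$, rows being numbered downwards. For $a\in\mathbb Z$, let $\mathrm{DM}(S,a)$ be the category of differential modules of degree $a$: graded $S$-modules $D$ with an $S$-linear $d$ such that $d^2=0$ and $d(D_j)\subseteq D_{j+a}$; morphisms are degree-$0$ linear maps commuting with $d$. The homology $H(D)=\ker d/\operatorname{im} d$ is a graded module, and a quasi-isomorphism is a morphism inducing an isomorphism on homology. A free flag is a $D$ with a splitting $D=\bigoplus_{i\ge0}D^{(i)}$ into graded free modules such that $d(D^{(i)})\subseteq\bigoplus_{j<i}D^{(j)}$. A minimal free resolution of $D$ is a quasi-isomorphism $G\to D$ with $G$ graded free and $d^G\otimes_S\Bbbk=0$ that factors as $G\to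 F\to D$, where $F$ is a free flag, $F\to D$ is a quasi-isomorphism and $G\to F$ is a split injection of differential modules. The total Betti number is $\beta(D)=\sum_{j}\dim_\Bbbk H(G\otimes_S\Bbbk)_j$ for a minimal free resolution $G$ of $D$, and $D$ is Betti-deficient if $\beta(D)<\beta(H(D))$, where $H(D)$ is regarded as an object of $\mathrm{DM}(S,a)$ with zero endomorphism. **Theorem.** If there is a Betti-deficient $D\in\mathrm{DM}(S,a)$ with $H(D)\cong M$ as graded modules, then the Betti table of $M$ has two nonzero entries lying on a line of slope $1-a+\frac aj$ for some integer $j\ge2$, where $j$ is the distance between their columns (so that the columns are not adjacent). Explicitly: there are $c\ge 0$, $j\ge2$ and $r_1,r_2\in\mathbb Z$ such that the entry in column $c$, row $r_1$ and the entry in column $c+j$, row $r_2$ are both nonzero, and $$\frac{r_1-r_2}{j}=1-a+\frac aj .$$ -/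

import Mathlib

universe u

open scoped TensorProduct

noncomputable section

/-! Graded modules, differential modules and Betti numbers over an `ℕ`-graded ring `S` whose
degree-zero component is local. -/

namespace DiffMod

variable {S : Type u} [CommRing S] (𝒮 : ℕ → AddSubgroup S) [GradedRing 𝒮]

/-- The homology `ker d / im d` of an endomorphism `d` of a module (meant for `d * d = 0`). -/
abbrev EndHomology {R V : Type u} [Ring R] [AddCommGroup V] [Module R V] (d : V →ₗ[R] V) :
    Type u :=
  LinearMap.ker d ⧸ (LinearMap.range d).submoduleOf (LinearMap.ker d)

/-- The classes of those cycles that lie in the submodule `N`. -/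
def EndHomology.classesOf {R V : Type u} [Ring R] [AddCommGroup V] [Module R V]
    (d : V →ₗ[R] V) (N : Submodule R V) : Submodule R (EndHomology d) :=
  (N.submoduleOf (LinearMap.ker d)).map (Submodule.mkQ _)

/-- The residue field `𝕜` of the local ring `S₀`. -/
def ResField [IsLocalRing (𝒮 0)] : Type u := IsLocalRing.ResidueField (𝒮 0)

instance [IsLocalRing (𝒮 0)] : Field (ResField 𝒮) :=
  inferInstanceAs (Field (IsLocalRing.ResidueField (𝒮 0)))

/-- `𝕜` is an `S`-algebra through `S → S₀ → 𝕜`, the first map being the projection. -/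
instance [IsLocalRing (𝒮 0)] : Algebra S (ResField 𝒮) :=
  RingHom.toAlgebra
    ((IsLocalRing.residue (𝒮 0)).comp (GradedRing.projZeroRingHom' 𝒮) :
      S →+* IsLocalRing.ResidueField (𝒮 0))

/-- A `ℤ`-graded module over the graded ring `S`. -/
structure GrMod where
  carrier : Type u
  [addCommGroup : AddCommGroup carrier]
  [module : Module S carrier]
  /-- `deg j` is the component of degree `j`. -/
  deg : ℤ → AddSubgroup carrier
  isInternal : DirectSum.IsInternal deg
  smul_mem : ∀ {i : ℕ} {j : ℤ} {s : S} {x : carrier},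
    s ∈ 𝒮 i → x ∈ deg j → s • x ∈ deg ((i : ℤ) + j)

attribute [instance] GrMod.addCommGroup GrMod.module

instance : CoeSort (GrMod 𝒮) (Type u) := ⟨GrMod.carrier⟩

variable {𝒮}

namespace GrMod

/-- Graded modules are isomorphic when there is a linear isomorphism of degree `0`. -/
def Isom (M N : GrMod 𝒮) : Prop :=
  ∃ e : M ≃ₗ[S] N, ∀ (j : ℤ) (x : M), x ∈ M.deg j ↔ e x ∈ N.deg j

/-- A submodule of a graded module is graded free if it has a basis of homogeneous elements,
i.e. if it is a direct sum of twists `S(-k)`. -/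
def IsGradedFree (M : GrMod 𝒮) (N : Submodule S M) : Prop :=
  ∃ (ι : Type u) (b : Module.Basis ι S N), ∀ e : ι, ∃ k : ℤ, (b e : M) ∈ M.deg k

/-- The component of degree `j` of the graded vector space `𝕜 ⊗ M`. -/
def fiberDeg [IsLocalRing (𝒮 0)] (M : GrMod 𝒮) (j : ℤ) :
    Submodule (ResField 𝒮) (ResField 𝒮 ⊗[S] M) :=
  Submodule.span (ResField 𝒮) {t | ∃ x ∈ M.deg j, t = 1 ⊗ₜ[S] x}

/-- A minimal graded free resolution `⋯ → P 2 → P 1 → P 0 → M → 0` with finitely generated terms;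
`P i` is the direct sum of the `S(-k)`, one for each `e : Fin (rank i)` with `shift i e = k`. -/
structure MinFreeRes [IsLocalRing (𝒮 0)] (M : GrMod 𝒮) where
  P : ℕ → GrMod 𝒮
  rank : ℕ → ℕ
  basis : ∀ i, Module.Basis (Fin (rank i)) S (P i)
  shift : ∀ i, Fin (rank i) → ℤ
  basis_mem : ∀ i e, basis i e ∈ (P i).deg (shift i e)
  d : ∀ i, P (i + 1) →ₗ[S] P i
  d_mem : ∀ (i : ℕ) (j : ℤ) (x : P (i + 1)), x ∈ (P (i + 1)).deg j → d i x ∈ (P i).deg j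
  aug : P 0 →ₗ[S] M
  aug_mem : ∀ (j : ℤ) (x : P 0), x ∈ (P 0).deg j → aug x ∈ M.deg j
  aug_surjective : Function.Surjective aug
  exact_zero : Function.Exact (d 0) aug
  exact_succ : ∀ i, Function.Exact (d (i + 1)) (d i)
  minimal : ∀ i, (d i).baseChange (ResField 𝒮) = 0

open Classical in
/-- The graded Betti number `β_{i,k}` of a finitely generated graded module `M`: the number of
summands `S(-k)` in the `i`-th term of a minimal graded free resolution of `M`. Minimal graded
free resolutions are unique up to isomorphism, so the choice does not matter, and over a
Noetherian `S` every finitely generated `M` has one, so the value `0` of the second case never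
occurs for such `M`. -/
def betti [IsLocalRing (𝒮 0)] (M : GrMod 𝒮) (i : ℕ) (k : ℤ) : ℕ :=
  if h : Nonempty (MinFreeRes M) then
    Nat.card {e : Fin (h.some.rank i) // h.some.shift i e = k}
  else 0

/-- The entry in column `c` and row `r` of the Betti table of `M`, which is `β_{c, r + c}`. -/
def bettiTable [IsLocalRing (𝒮 0)] (M : GrMod 𝒮) (c : ℕ) (r : ℤ) : ℕ :=
  M.betti c (r + c)

end GrMod

variable (𝒮) in
/-- The objects of `DM(S, a)`: graded modules `D` with a square-zero endomorphism that is a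
graded map `D → D(a)`. -/
structure DM (a : ℤ) extends GrMod 𝒮 where
  d : carrier →ₗ[S] carrier
  d_d : ∀ x, d (d x) = 0
  d_mem : ∀ {j : ℤ} {x : carrier}, x ∈ deg j → d x ∈ deg (j + a)

namespace DM

variable {a : ℤ}

instance : CoeSort (DM 𝒮 a) (Type u) := ⟨fun D => D.carrier⟩

/-- The module underlying the homology `ker d / im d`. -/
abbrev H (D : DM 𝒮 a) : Type u := EndHomology D.d

/-- The classes of the cycles of degree `j`. -/
def homologyDeg (D : DM 𝒮 a) (j : ℤ) : AddSubgroup D.H :=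
  ((D.deg j).comap (LinearMap.ker D.d).subtype.toAddMonoidHom).map
    ((LinearMap.range D.d).submoduleOf (LinearMap.ker D.d)).mkQ.toAddMonoidHom

theorem mem_homologyDeg (D : DM 𝒮 a) (j : ℤ) (h : D.H) :
    h ∈ D.homologyDeg j ↔ ∃ z : LinearMap.ker D.d, (z : D) ∈ D.deg j ∧
      Submodule.Quotient.mk z = h := Iff.rfl

theorem exists_components (D : DM 𝒮 a) : ∃ p : ℤ → D →+ D,
    (∀ j x, p j x ∈ D.deg j) ∧ (∀ j x, x ∈ D.deg j → p j x = x) ∧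
    (∀ i j x, x ∈ D.deg i → i ≠ j → p j x = 0) ∧
    (∀ x, ∃ s : Finset ℤ, ∑ j ∈ s, p j x = x) ∧
    (∀ j x, p (j + a) (D.d x) = D.d (p j x)) := by
  classical
  let _ : DirectSum.Decomposition D.deg := D.isInternal.chooseDecomposition
  let p : ℤ → D →+ D := fun j =>
    { toFun := fun x => (DirectSum.decompose D.deg x j : D)
      map_zero' := by simp
      map_add' := by intro x y; simp }
  have hmem : ∀ j x, p j x ∈ D.deg j := fun j x => SetLike.coe_mem _
  have hsame : ∀ j x, x ∈ D.deg j → p j x = x := fun j x hx =>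
    DirectSum.decompose_of_mem_same D.deg hx
  have hne : ∀ i j x, x ∈ D.deg i → i ≠ j → p j x = 0 := fun i j x hx hij =>
    DirectSum.decompose_of_mem_ne D.deg hx hij
  refine ⟨p, hmem, hsame, hne,
    fun x => ⟨_, DirectSum.sum_support_decompose D.deg x⟩, ?_⟩
  intro j x
  induction x using DirectSum.Decomposition.inductionOn D.deg with
  | zero => simp
  | @homogeneous i m =>
    by_cases hij : i = j
    · subst hij
      rw [hsame _ _ (D.d_mem m.2), hsame _ _ m.2]
    · rw [hne _ _ _ (D.d_mem m.2) (by omega), hne _ _ _ m.2 hij, map_zero]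
  | add x y hx hy => simp only [map_add, hx, hy]

theorem homology_isInternal (D : DM 𝒮 a) : DirectSum.IsInternal D.homologyDeg := by
  classical
  obtain ⟨p, hmem, hsame, hne, hsum, hd⟩ := D.exists_components
  constructor
  · rw [injective_iff_map_eq_zero]
    intro z hz
    have hr : ∀ j, ∃ r : LinearMap.ker D.d, (r : D) ∈ D.deg j ∧
        (Submodule.Quotient.mk r : D.H) = (z j : D.H) := fun j =>
      (D.mem_homologyDeg j _).1 (z j).2
    choose r hrdeg hrz using hr
    rw [DirectSum.coeAddMonoidHom_eq_dfinsuppSum, DFinsupp.sum] at hz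
    have h1 : (Submodule.Quotient.mk (∑ j ∈ z.support, r j) : D.H) = 0 := by
      rw [← Submodule.mkQ_apply, map_sum, ← hz]
      exact Finset.sum_congr rfl fun j _ => hrz j
    rw [Submodule.Quotient.mk_eq_zero] at h1
    obtain ⟨y, hy⟩ := h1
    ext j
    by_cases hj : j ∈ z.support
    · have h2 : D.d (p (j - a) y) = r j := by
        rw [← hd, sub_add_cancel, hy, Submodule.subtype_apply]
        have : ((∑ j ∈ z.support, r j : LinearMap.ker D.d) : D) = ∑ j ∈ z.support, (r j : D) := by
          simp
        rw [this, map_sum, Finset.sum_eq_single j]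
        · exact hsame _ _ (hrdeg j)
        · intro i _ hij
          exact hne _ _ _ (hrdeg i) hij
        · intro h
          exact absurd hj h
      rw [← hrz j]
      have : (Submodule.Quotient.mk (r j) : D.H) = 0 := by
        rw [Submodule.Quotient.mk_eq_zero]
        exact ⟨_, h2⟩
      rw [this]
      rfl
    · rw [DFinsupp.notMem_support_iff.1 hj]
      rfl
  · intro h
    obtain ⟨z, rfl⟩ := Submodule.Quotient.mk_surjective _ h
    have hz : ∀ j, D.d (p j z) = 0 := fun j => by
      rw [← hd, LinearMap.mem_ker.1 z.2, map_zero]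
    obtain ⟨s, hs⟩ := hsum z
    refine ⟨∑ j ∈ s, DirectSum.of (fun j => D.homologyDeg j) j
      ⟨Submodule.Quotient.mk ⟨p j z, hz j⟩, ⟨⟨p j z, hz j⟩, hmem j z, rfl⟩⟩, ?_⟩
    rw [map_sum]
    simp only [DirectSum.coeAddMonoidHom_of]
    simp only [← Submodule.mkQ_apply]
    rw [← map_sum]
    congr 1
    ext
    simpa using hs

/-- The homology of a differential module, as a graded module; its component of degree `j` is
`(ker d)_j / d (D_{j - a})`. -/
def homology (D : DM 𝒮 a) : GrMod 𝒮 where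
  carrier := D.H
  deg := D.homologyDeg
  isInternal := D.homology_isInternal
  smul_mem := by
    rintro i j s _ hs ⟨z, hz, rfl⟩
    exact ⟨s • z, D.smul_mem hs hz, rfl⟩

/-- A morphism of differential modules, homogeneous of degree `0`. -/
structure Hom (D E : DM 𝒮 a) where
  f : D →ₗ[S] E
  f_mem : ∀ {j : ℤ} {x : D}, x ∈ D.deg j → f x ∈ E.deg j
  comm : ∀ x, f (D.d x) = E.d (f x)

/-- The map induced on cycles. -/
def Hom.cycles {D E : DM 𝒮 a} (φ : Hom D E) : LinearMap.ker D.d →ₗ[S] LinearMap.ker E.d :=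
  φ.f.restrict fun x hx => by
    rw [LinearMap.mem_ker] at hx ⊢
    rw [← φ.comm, hx, map_zero]

/-- The map induced on homology. -/
def Hom.homologyMap {D E : DM 𝒮 a} (φ : Hom D E) : D.H →ₗ[S] E.H :=
  Submodule.mapQ _ _ φ.cycles (by
    rintro z ⟨y, hy⟩
    exact ⟨φ.f y, by rw [← φ.comm, hy]; rfl⟩)

def Hom.IsQuasiIso {D E : DM 𝒮 a} (φ : Hom D E) : Prop :=
  Function.Bijective φ.homologyMap

/-- `D` is a free flag: `D = ⨁ F i` over `i ≥ 0` with every `F i` (graded) free, and `d` maps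
`F i` into the sum of the `F j` with `j < i`. -/
def IsFreeFlag (D : DM 𝒮 a) : Prop :=
  ∃ F : ℕ → Submodule S D, DirectSum.IsInternal F ∧
    (∀ i, D.toGrMod.IsGradedFree (F i)) ∧
    ∀ i, ∀ x ∈ F i, D.d x ∈ ⨆ j, ⨆ _ : j < i, F j

def IsMinimal [IsLocalRing (𝒮 0)] (D : DM 𝒮 a) : Prop :=
  D.d.baseChange (ResField 𝒮) = 0

/-- `G` is a minimal free resolution of `D`: it is free and minimal, and there is a
quasi-isomorphism `G → F → D`, where `F → D` is a quasi-isomorphism from a free flag and `G → F`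
is a split injection of differential modules. -/
def IsMinFreeRes [IsLocalRing (𝒮 0)] (G D : DM 𝒮 a) : Prop :=
  G.toGrMod.IsGradedFree ⊤ ∧ G.IsMinimal ∧
    ∃ (F : DM 𝒮 a) (i : Hom G F) (r : Hom F G) (ε : Hom F D) (η : Hom G D),
      F.IsFreeFlag ∧ ε.IsQuasiIso ∧ η.IsQuasiIso ∧
      (∀ x, r.f (i.f x) = x) ∧ (∀ x, η.f x = ε.f (i.f x))

/-- The differential of `𝕜 ⊗ D`. -/
def fiberD [IsLocalRing (𝒮 0)] (D : DM 𝒮 a) :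
    ResField 𝒮 ⊗[S] D →ₗ[ResField 𝒮] ResField 𝒮 ⊗[S] D :=
  D.d.baseChange (ResField 𝒮)

/-- `dim_𝕜 H(𝕜 ⊗ D)_j`. -/
def fiberHomologyDim [IsLocalRing (𝒮 0)] (D : DM 𝒮 a) (j : ℤ) : Cardinal.{u} :=
  Module.rank (ResField 𝒮) (EndHomology.classesOf D.fiberD (D.toGrMod.fiberDeg j))

/-- `c` is the total Betti number `β(D) = ∑_j β_j(D)`, where `β_j(D) = dim_𝕜 H(𝕜 ⊗ G)_j` for a
minimal free resolution `G` of `D`. -/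
def HasTotalBetti [IsLocalRing (𝒮 0)] (D : DM 𝒮 a) (c : Cardinal.{u}) : Prop :=
  ∃ G : DM 𝒮 a, G.IsMinFreeRes D ∧ c = Cardinal.sum G.fiberHomologyDim

end DM

/-- A graded module as a differential module with zero endomorphism. -/
def GrMod.toDM (M : GrMod 𝒮) (a : ℤ) : DM 𝒮 a where
  toGrMod := M
  d := 0
  d_d _ := rfl
  d_mem _ := (M.deg _).zero_mem

/-- `D` is Betti-deficient: `β(D) < β(H(D))`. -/
def DM.IsBettiDeficient [IsLocalRing (𝒮 0)] {a : ℤ} (D : DM 𝒮 a) : Prop :=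
  ∃ c c' : Cardinal.{u}, D.HasTotalBetti c ∧ (D.homology.toDM a).HasTotalBetti c' ∧ c < c'

end DiffMod

end

/-! Contrapositive: if no two Betti entries of `M` lie on such a line, every `D` of degree `a` with
homology `M` has the same total Betti number, so `D` cannot have fewer than `H(D)` with zero
differential.

Take a minimal graded free resolution `R` of `M`, with terms `P i`. The direct sum of the `P i`,
with `P i` twisted by `a * i`, carries a flag differential `d` whose component from `P (i + 1)` to
`P i` is the map of the resolution, together with a quasi-isomorphism to `D` (`exists_flag`,
`isQuis_of_flag`). The remaining components, from `P (m + j)` to `P m` with `j ≥ 2`, are corrections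
for the differential of `D`; they are built summand by summand in `exists_correction`, using
exactness of `R`, and made homogeneous afterwards.

A matrix entry of `d` survives in the residue field only if it has degree zero. For a correction
this forces the two shifts to differ by `a * (j - 1)`, which is the line condition for the Betti
table. If that never happens, `d` vanishes over `𝕜` (`minimal_of_flag`).

A flag is homotopy projective, as is any summand of one, so the flag built from `R` and any minimal
free resolution of `D` are homotopy equivalent. Over `𝕜` both differentials are zero, the homotopies
disappear, and the ranks agree (`rank_baseChange_eq_of_homotopy`). Thus `β(D)` is the total rank of
`R`, a number that depends on `M` alone. -/

noncomputable section

namespace DiffMod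

set_option linter.unusedSectionVars false

/-! ### Homotopy projective differential modules and uniqueness of resolutions -/

section Homotopy

variable {S : Type u} [CommRing S]

/-- `P` with the endomorphism `d` is homotopy projective: every chain map to an acyclic
differential module is null-homotopic. -/
def IsHomotopyProjective {P : Type u} [AddCommGroup P] [Module S P] (d : P →ₗ[S] P) : Prop :=
  ∀ (C : Type u) [AddCommGroup C] [Module S C] (dC : C →ₗ[S] C), (∀ x, dC (dC x) = 0) →
    (∀ x, dC x = 0 → ∃ y, dC y = x) → ∀ φ : P →ₗ[S] C, (∀ x, φ (d x) = dC (φ x)) →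
      ∃ h : P →ₗ[S] C, ∀ x, φ x = dC (h x) + h (d x)

/-- Elementwise form of a quasi-isomorphism of (ungraded) differential modules. -/
structure IsQuis {X Y : Type u} [AddCommGroup X] [Module S X] [AddCommGroup Y] [Module S Y]
    (dX : X →ₗ[S] X) (dY : Y →ₗ[S] Y) (q : X →ₗ[S] Y) : Prop where
  comm : ∀ x, q (dX x) = dY (q x)
  inj : ∀ x, dX x = 0 → (∃ y, dY y = q x) → ∃ x', dX x' = x
  surj : ∀ y, dY y = 0 → ∃ x y', dX x = 0 ∧ y = q x + dY y'

variable {P Q X Y : Type u} [AddCommGroup P] [Module S P] [AddCommGroup Q] [Module S Q]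
  [AddCommGroup X] [Module S X] [AddCommGroup Y] [Module S Y]

theorem IsHomotopyProjective.of_retract {dP : P →ₗ[S] P} {dQ : Q →ₗ[S] Q}
    (hQ : IsHomotopyProjective dQ) (i : P →ₗ[S] Q) (r : Q →ₗ[S] P)
    (hi : ∀ x, i (dP x) = dQ (i x)) (hr : ∀ x, r (dQ x) = dP (r x)) (hri : ∀ x, r (i x) = x) :
    IsHomotopyProjective dP := by
  intro C _ _ dC hdC hC φ hφ
  obtain ⟨h, hh⟩ := hQ C dC hdC hC (φ ∘ₗ r) fun x => by simp [hr, hφ]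
  refine ⟨h ∘ₗ i, fun x => ?_⟩
  have := hh (i x)
  simpa [hri, hi] using this

/-- Changing the sign of both differentials preserves chain maps and acyclicity. The sign is needed
in `IsQuis.nullHomotopic`, where the cone carries `-dX` on its first factor. -/
theorem IsHomotopyProjective.neg {d : P →ₗ[S] P} (hP : IsHomotopyProjective d) :
    IsHomotopyProjective (-d) := by
  intro C _ _ dC hdC hC φ hφ
  obtain ⟨h, hh⟩ := hP C (-dC) (by simp [hdC])
    (fun x hx => by
      obtain ⟨y, hy⟩ := hC x (by simpa using hx)
      exact ⟨-y, by simp [hy]⟩) φ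
    (fun x => by
      have := hφ x
      simp only [LinearMap.neg_apply, map_neg] at this ⊢
      rw [← this, neg_neg])
  refine ⟨-h, fun x => ?_⟩
  rw [hh x]
  simp

/-- The differential of the mapping cone. -/
def coneD (dX : X →ₗ[S] X) (dY : Y →ₗ[S] Y) (q : X →ₗ[S] Y) : X × Y →ₗ[S] X × Y :=
  (-(dX ∘ₗ LinearMap.fst S X Y)).prod (q ∘ₗ LinearMap.fst S X Y + dY ∘ₗ LinearMap.snd S X Y)

@[simp] theorem coneD_apply (dX : X →ₗ[S] X) (dY : Y →ₗ[S] Y) (q : X →ₗ[S] Y) (z : X × Y) :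
    coneD dX dY q z = (-dX z.1, q z.1 + dY z.2) := rfl

variable {dX : X →ₗ[S] X} {dY : Y →ₗ[S] Y} {q : X →ₗ[S] Y}

theorem IsQuis.coneD_coneD (hq : IsQuis dX dY q) (hX : ∀ x, dX (dX x) = 0)
    (hY : ∀ y, dY (dY y) = 0) (z : X × Y) : coneD dX dY q (coneD dX dY q z) = 0 := by
  simp [hX, hY, hq.comm]

theorem IsQuis.cone_acyclic (hq : IsQuis dX dY q) (z : X × Y) (hz : coneD dX dY q z = 0) :
    ∃ w, coneD dX dY q w = z := by
  obtain ⟨x, y⟩ := z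
  simp only [coneD_apply, Prod.mk_eq_zero, neg_eq_zero] at hz
  obtain ⟨hx, hxy⟩ := hz
  obtain ⟨x', rfl⟩ := hq.inj x hx ⟨-y, by rw [map_neg, eq_comm]; exact eq_neg_of_add_eq_zero_left hxy⟩
  -- With `z = (dX x', y)`, the element `q x' + y` is a cycle of `Y`; the cycle `x''` representing
  -- its class corrects `-x'` without changing the first coordinate of the boundary.
  obtain ⟨x'', y', hx'', hy'⟩ := hq.surj (q x' + y) (by rw [map_add, ← hq.comm, hxy])
  refine ⟨(x'' - x', y'), ?_⟩
  have : q x'' - q x' + dY y' = y := by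
    rw [sub_add_eq_add_sub, ← hy', add_sub_cancel_left]
  simp [hx'', this]

/-- The map `(0, f)` into the acyclic cone is null-homotopic; the two coordinates of the
null-homotopy are the lift and the homotopy. -/
theorem IsQuis.exists_lift (hq : IsQuis dX dY q) (hX : ∀ x, dX (dX x) = 0)
    (hY : ∀ y, dY (dY y) = 0) {d : P →ₗ[S] P} (hP : IsHomotopyProjective d) (f : P →ₗ[S] Y)
    (hf : ∀ x, f (d x) = dY (f x)) :
    ∃ (g : P →ₗ[S] X) (h : P →ₗ[S] Y), (∀ x, g (d x) = dX (g x)) ∧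
      ∀ x, f x = q (g x) + (dY (h x) + h (d x)) := by
  obtain ⟨h, hh⟩ := hP (X × Y) (coneD dX dY q) (hq.coneD_coneD hX hY) hq.cone_acyclic
    (LinearMap.inr S X Y ∘ₗ f) (fun x => by simp [hf])
  refine ⟨LinearMap.fst S X Y ∘ₗ h, LinearMap.snd S X Y ∘ₗ h, fun x => ?_, fun x => ?_⟩
  · have := congrArg Prod.fst (hh x)
    simp only [LinearMap.comp_apply, LinearMap.inr_apply, coneD_apply, Prod.fst_add] at this
    exact (neg_add_eq_zero.1 this.symm).symm
  · have := congrArg Prod.snd (hh x)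
    simpa [add_assoc] using this

/-- The pair `(g, -k)` is a chain map from `(P, -d)` to the acyclic cone; the first coordinate of a
null-homotopy, negated, contracts `g`. -/
theorem IsQuis.nullHomotopic (hq : IsQuis dX dY q) (hX : ∀ x, dX (dX x) = 0)
    (hY : ∀ y, dY (dY y) = 0) {d : P →ₗ[S] P} (hP : IsHomotopyProjective d) (g : P →ₗ[S] X)
    (hg : ∀ x, g (d x) = dX (g x)) (k : P →ₗ[S] Y)
    (hk : ∀ x, q (g x) = dY (k x) + k (d x)) :
    ∃ h : P →ₗ[S] X, ∀ x, g x = dX (h x) + h (d x) := by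
  obtain ⟨h, hh⟩ := hP.neg (X × Y) (coneD dX dY q) (hq.coneD_coneD hX hY) hq.cone_acyclic
    (g.prod (-k)) (fun x => by simp [hg, hk])
  refine ⟨-(LinearMap.fst S X Y ∘ₗ h), fun x => ?_⟩
  have := congrArg Prod.fst (hh x)
  simpa using this

/-- Two homotopy projective resolutions of the same differential module are homotopy equivalent. -/
theorem IsQuis.exists_homotopy_inverse {Z : Type u} [AddCommGroup Z] [Module S Z]
    {dZ : Z →ₗ[S] Z} {p : X →ₗ[S] Z} {q : Y →ₗ[S] Z} (hp : IsQuis dX dZ p) (hq : IsQuis dY dZ q)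
    (hdX : ∀ x, dX (dX x) = 0) (hdY : ∀ x, dY (dY x) = 0) (hdZ : ∀ x, dZ (dZ x) = 0)
    (hX : IsHomotopyProjective dX) (hY : IsHomotopyProjective dY) :
    ∃ (u : X →ₗ[S] Y) (v : Y →ₗ[S] X) (h : X →ₗ[S] X) (k : Y →ₗ[S] Y),
      (∀ x, v (u x) = x + (dX (h x) + h (dX x))) ∧
      ∀ y, u (v y) = y + (dY (k y) + k (dY y)) := by
  obtain ⟨u, h, hu, huh⟩ := hq.exists_lift hdY hdZ hX p hp.comm
  obtain ⟨v, k, hv, hvk⟩ := hp.exists_lift hdX hdZ hY q hq.comm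
  -- After composing with `p`, the homotopies `p v u ~ q u ~ p` add up to `-(k ∘ u + h)`; since `p`
  -- is a quasi-isomorphism, `v u ~ id` already holds before composing.
  obtain ⟨h', hh'⟩ := hp.nullHomotopic hdX hdZ hX (v ∘ₗ u - LinearMap.id)
    (fun x => by simp [hu, hv]) (-(h + k ∘ₗ u)) (fun x => by
      have h1 := huh x
      have h2 := hvk (u x)
      have h3 : p (v (u x)) = q (u x) - (dZ (k (u x)) + k (u (dX x))) := by
        rw [h2, hu]; abel
      have h4 : q (u x) = p x - (dZ (h x) + h (dX x)) := by
        rw [h1]; abel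
      simp only [LinearMap.sub_apply, LinearMap.comp_apply, LinearMap.id_apply, map_sub,
        LinearMap.neg_apply, LinearMap.add_apply, map_neg, map_add]
      rw [h3, h4]
      abel)
  obtain ⟨k', hk'⟩ := hq.nullHomotopic hdY hdZ hY (u ∘ₗ v - LinearMap.id)
    (fun x => by simp [hu, hv]) (-(k + h ∘ₗ v)) (fun x => by
      have h1 := hvk x
      have h2 := huh (v x)
      have h3 : q (u (v x)) = p (v x) - (dZ (h (v x)) + h (v (dY x))) := by
        rw [h2, hv]; abel
      have h4 : p (v x) = q x - (dZ (k x) + k (dY x)) := by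
        rw [h1]; abel
      simp only [LinearMap.sub_apply, LinearMap.comp_apply, LinearMap.id_apply, map_sub,
        LinearMap.neg_apply, LinearMap.add_apply, map_neg, map_add]
      rw [h3, h4]
      abel)
  refine ⟨u, v, h', k', fun x => ?_, fun y => ?_⟩
  · rw [← hh']; simp
  · rw [← hk']; simp

/-- Each homotopy term has a factor `dX` or `dY`, so over `K` the maps `u` and `v` become mutually
inverse. -/
theorem rank_baseChange_eq_of_homotopy (K : Type u) [Field K] [Algebra S K]
    (hdX : dX.baseChange K = 0) (hdY : dY.baseChange K = 0)
    (u : X →ₗ[S] Y) (v : Y →ₗ[S] X) (h : X →ₗ[S] X) (k : Y →ₗ[S] Y)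
    (hh : ∀ x, v (u x) = x + (dX (h x) + h (dX x)))
    (hk : ∀ y, u (v y) = y + (dY (k y) + k (dY y))) :
    Module.rank K (K ⊗[S] X) = Module.rank K (K ⊗[S] Y) := by
  have e1 : v ∘ₗ u = LinearMap.id + (dX ∘ₗ h + h ∘ₗ dX) := LinearMap.ext hh
  have e2 : u ∘ₗ v = LinearMap.id + (dY ∘ₗ k + k ∘ₗ dY) := LinearMap.ext hk
  refine (LinearEquiv.ofLinearMap (u.baseChange K) (v.baseChange K) ?_ ?_).rank_eq
  · rw [← LinearMap.baseChange_comp, e2]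
    simp [LinearMap.baseChange_add, LinearMap.baseChange_comp, hdY]
  · rw [← LinearMap.baseChange_comp, e1]
    simp [LinearMap.baseChange_add, LinearMap.baseChange_comp, hdX]

end Homotopy

/-! ### Direct sums filtered by index, and homotopy projectivity of flags -/

section DirectSum

open DirectSum

variable {S : Type u} [CommRing S] (P : ℕ → Type u) [∀ i, AddCommGroup (P i)]
  [∀ i, Module S (P i)]

/-- The elements of `⨁ i, P i` supported on the indices below `n`. -/
def supportedBelow (n : ℕ) : Submodule S (⨁ i, P i) where
  carrier := {t | ∀ m, n ≤ m → t m = 0}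
  add_mem' := fun ha hb m hm => by simp [ha m hm, hb m hm]
  zero_mem' := fun _ _ => rfl
  smul_mem' := fun c x hx m hm => by rw [DirectSum.smul_apply, hx m hm, smul_zero]

variable {P}

theorem supportedBelow_mono {m n : ℕ} (h : m ≤ n) {t : ⨁ i, P i}
    (ht : t ∈ supportedBelow (S := S) P m) : t ∈ supportedBelow (S := S) P n :=
  fun k hk => ht k (h.trans hk)

theorem lof_mem_supportedBelow {i n : ℕ} (h : i < n) (x : P i) :
    lof S ℕ P i x ∈ supportedBelow (S := S) P n := fun m hm => by
  rw [lof_eq_of, of_eq_of_ne]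
  omega

theorem exists_mem_supportedBelow (t : ⨁ i, P i) : ∃ n, t ∈ supportedBelow (S := S) P n := by
  classical
  refine ⟨(DFinsupp.support t).sup id + 1, fun m hm => ?_⟩
  by_contra h
  have := Finset.le_sup (f := id) (DFinsupp.mem_support_iff.2 h)
  simp only [id] at this
  omega

theorem eqOn_supportedBelow {X : Type*} [AddCommGroup X] [Module S X] {n : ℕ}
    {f g : (⨁ i, P i) →ₗ[S] X} (h : ∀ i < n, ∀ x, f (lof S ℕ P i x) = g (lof S ℕ P i x))
    {t : ⨁ i, P i} (ht : t ∈ supportedBelow (S := S) P n) : f t = g t := by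
  classical
  rw [← DirectSum.sum_support_of t, map_sum, map_sum]
  refine Finset.sum_congr rfl fun i hi => h i ?_ _
  by_contra hn
  exact DFinsupp.mem_support_iff.1 hi (ht i (not_lt.1 hn))

theorem supportedBelow_zero {t : ⨁ i, P i} (ht : t ∈ supportedBelow (S := S) P 0) : t = 0 := by
  ext i
  rw [ht i (Nat.zero_le _)]
  rfl

/-- The stages of a recursive construction of a family of linear maps on the summands, glued to a
linear map on the direct sum. -/
theorem exists_limit {X : Type*} [AddCommGroup X] [Module S X] (f : ℕ → (⨁ i, P i) →ₗ[S] X)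
    (h : ∀ n, ∀ i ≤ n, ∀ x, f (n + 1) (lof S ℕ P i x) = f n (lof S ℕ P i x)) :
    ∃ g : (⨁ i, P i) →ₗ[S] X, ∀ n, ∀ t ∈ supportedBelow (S := S) P (n + 1), g t = f n t := by
  have h' : ∀ i k x, f (i + k) (lof S ℕ P i x) = f i (lof S ℕ P i x) := by
    intro i k x
    induction k with
    | zero => rfl
    | succ k ih => rw [← ih, ← add_assoc, h _ _ (Nat.le_add_right i k)]
  refine ⟨toModule S ℕ X fun i => f i ∘ₗ lof S ℕ P i, fun n t ht => ?_⟩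
  refine eqOn_supportedBelow (fun i hi x => ?_) ht
  obtain ⟨k, rfl⟩ := Nat.exists_eq_add_of_le (Nat.lt_succ_iff.1 hi)
  rw [toModule_lof, h']
  rfl

/-- The contraction is built one summand at a time: on `P n` the defect `φ - h ∘ d` involves only
values of `h` already fixed, takes values in cycles, hence in boundaries, and lifts through `dC`
because `P n` is projective. -/
theorem isHomotopyProjective_directSum [∀ i, Module.Projective S (P i)]
    (d : (⨁ i, P i) →ₗ[S] ⨁ i, P i) (hd : ∀ x, d (d x) = 0)
    (hflag : ∀ i x, d (lof S ℕ P i x) ∈ supportedBelow (S := S) P i) :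
    IsHomotopyProjective d := by
  intro C _ _ dC hdC hC φ hφ
  have step : ∀ (n : ℕ) (h : (⨁ i, P i) →ₗ[S] C),
      (∀ i < n, ∀ x, φ (lof S ℕ P i x) =
        dC (h (lof S ℕ P i x)) + h (d (lof S ℕ P i x))) →
      ∃ h' : (⨁ i, P i) →ₗ[S] C, (∀ i < n, ∀ x, h' (lof S ℕ P i x) = h (lof S ℕ P i x)) ∧
        ∀ i < n + 1, ∀ x, φ (lof S ℕ P i x) =
          dC (h' (lof S ℕ P i x)) + h' (d (lof S ℕ P i x)) := by
    intro n h hh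
    let ψ : P n →ₗ[S] C := (φ - h ∘ₗ d) ∘ₗ lof S ℕ P n
    have hψ : ∀ x, dC (ψ x) = 0 := by
      intro x
      have : φ (d (lof S ℕ P n x)) = dC (h (d (lof S ℕ P n x))) + h (d (d (lof S ℕ P n x))) :=
        eqOn_supportedBelow (f := φ) (g := dC ∘ₗ h + h ∘ₗ d) hh (hflag n x)
      rw [hd, map_zero, add_zero] at this
      simp [ψ, ← hφ, this]
    let dC' : C →ₗ[S] LinearMap.ker dC := dC.codRestrict _ fun x => hdC x
    obtain ⟨g, hg⟩ := Module.projective_lifting_property dC'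
      (ψ.codRestrict (LinearMap.ker dC) hψ) (fun x => by
        obtain ⟨y, hy⟩ := hC x x.2
        exact ⟨y, Subtype.ext hy⟩)
    have hg' : ∀ x, dC (g x) = ψ x := fun x => congrArg Subtype.val (LinearMap.congr_fun hg x)
    let h' : (⨁ i, P i) →ₗ[S] C :=
      toModule S ℕ C (Function.update (fun i => h ∘ₗ lof S ℕ P i) n g)
    have hne : ∀ i < n, ∀ x, h' (lof S ℕ P i x) = h (lof S ℕ P i x) := by
      intro i hi x
      simp [h', toModule_lof, Function.update_of_ne hi.ne]
    have hn : ∀ x, h' (lof S ℕ P n x) = g x := by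
      intro x
      simp [h', toModule_lof]
    refine ⟨h', hne, fun i hi x => ?_⟩
    have hlow : h' (d (lof S ℕ P i x)) = h (d (lof S ℕ P i x)) :=
      eqOn_supportedBelow hne (supportedBelow_mono (by omega) (hflag i x))
    rw [hlow]
    rcases Nat.lt_succ_iff_lt_or_eq.1 hi with hi | rfl
    · rw [hne i hi, hh i hi]
    · rw [hn, hg']
      simp [ψ]
  let T : ∀ n, {h : (⨁ i, P i) →ₗ[S] C // ∀ i < n, ∀ x, φ (lof S ℕ P i x) =
        dC (h (lof S ℕ P i x)) + h (d (lof S ℕ P i x))} := fun n =>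
    Nat.rec ⟨0, fun i hi => absurd hi (Nat.not_lt_zero i)⟩
      (fun n h => ⟨(step n h.1 h.2).choose, (step n h.1 h.2).choose_spec.2⟩) n
  have hT : ∀ n, ∀ i < n, ∀ x, (T (n + 1)).1 (lof S ℕ P i x) = (T n).1 (lof S ℕ P i x) :=
    fun n => (step n (T n).1 (T n).2).choose_spec.1
  -- Stage `n` is constrained on indices below `n` only, so the stages are shifted by one for stage
  -- `n` of the sequence to be final on `P n`.
  obtain ⟨h, hh⟩ := exists_limit (fun n => (T (n + 1)).1) fun n i hi x =>
    hT (n + 1) i (Nat.lt_succ_of_le hi) x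
  refine ⟨h, fun x => ?_⟩
  refine LinearMap.congr_fun (f := φ) (g := dC ∘ₗ h + h ∘ₗ d) (linearMap_ext _ fun i => ?_) x
  ext y
  have h1 := (T (i + 1)).2 i (Nat.lt_succ_self i) y
  simp only [LinearMap.comp_apply, LinearMap.add_apply]
  rw [h1, hh i _ (lof_mem_supportedBelow (Nat.lt_succ_self i) y),
    hh i _ (supportedBelow_mono (Nat.le_succ i) (hflag i y))]

end DirectSum

/-! ### Homogeneous components of graded rings and modules -/

section GradedRings

theorem basis_induction {R A ι : Type*} [CommRing R] [AddCommGroup A] [Module R A]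
    (b : Module.Basis ι R A) {p : A → Prop} (h0 : p 0) (hadd : ∀ x y, p x → p y → p (x + y))
    (hsmul : ∀ (c : R) e, p (c • b e)) (x : A) : p x := by
  rw [← b.linearCombination_repr x, Finsupp.linearCombination_apply, Finsupp.sum]
  exact Finset.sum_induction _ p hadd h0 fun e _ => hsmul _ e

section Internal

theorem isInternal_of_proj {A : Type*} [AddCommGroup A] (deg : ℤ → AddSubgroup A)
    (p : ℤ → A →+ A) (hsame : ∀ j x, x ∈ deg j → p j x = x)
    (hne : ∀ i j x, x ∈ deg i → i ≠ j → p j x = 0) (htop : ∀ x, x ∈ ⨆ j, deg j) :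
    DirectSum.IsInternal deg := by
  classical
  constructor
  · rw [injective_iff_map_eq_zero]
    intro z hz
    rw [DirectSum.coeAddMonoidHom_eq_dfinsuppSum, DFinsupp.sum] at hz
    ext j
    by_cases hj : j ∈ z.support
    · have h := congrArg (p j) hz
      rw [map_sum, map_zero, Finset.sum_eq_single j] at h
      · rw [← hsame _ _ (z j).2, h]
        rfl
      · intro i _ hij
        exact hne _ _ _ (z i).2 hij
      · intro h
        exact absurd hj h
    · rw [DFinsupp.notMem_support_iff.1 hj]
      rfl
  · intro x
    have hx := htop x
    rw [← AddMonoidHom.mem_range]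
    refine AddSubgroup.iSup_induction (C := fun x => x ∈ (DirectSum.coeAddMonoidHom deg).range)
      deg hx (fun j y hy => ?_) (zero_mem _) fun a b ha hb => add_mem ha hb
    exact ⟨DirectSum.of (fun j => deg j) j ⟨y, hy⟩, DirectSum.coeAddMonoidHom_of _ _ _⟩

end Internal

variable {S : Type u} [CommRing S] {𝒮 : ℕ → AddSubgroup S} [GradedRing 𝒮]

variable (𝒮) in
/-- The component of degree `n` of an element of `S`, for an integer `n`. -/
def ringProj (n : ℤ) : S →+ S := if 0 ≤ n then GradedRing.proj 𝒮 n.toNat else 0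

theorem ringProj_same {i : ℕ} {s : S} (hs : s ∈ 𝒮 i) : ringProj 𝒮 i s = s := by
  rw [ringProj, if_pos (Int.natCast_nonneg i)]
  exact DirectSum.decompose_of_mem_same 𝒮 hs

theorem ringProj_ne {i : ℕ} {n : ℤ} {s : S} (hs : s ∈ 𝒮 i) (h : (i : ℤ) ≠ n) :
    ringProj 𝒮 n s = 0 := by
  rw [ringProj]
  split_ifs with hn
  · exact DirectSum.decompose_of_mem_ne 𝒮 hs (by omega)
  · rfl

variable (𝒮) in
theorem ring_induction {p : S → Prop} (h0 : p 0) (hom : ∀ i s, s ∈ 𝒮 i → p s)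
    (hadd : ∀ s t, p s → p t → p (s + t)) (s : S) : p s := by
  classical
  induction s using DirectSum.Decomposition.inductionOn 𝒮 with
  | zero => exact h0
  | homogeneous m => exact hom _ _ m.2
  | add x y hx hy => exact hadd _ _ hx hy

variable (𝒮) in
/-- The elements of degree `n` of `S`, for an integer `n`. -/
def ringDeg (n : ℤ) : AddSubgroup S := if 0 ≤ n then 𝒮 n.toNat else ⊥

theorem ringDeg_natCast (i : ℕ) : ringDeg 𝒮 i = 𝒮 i := by
  rw [ringDeg, if_pos (Int.natCast_nonneg i), Int.toNat_natCast]

theorem ringDeg_cases {n : ℤ} {s : S} (hs : s ∈ ringDeg 𝒮 n) :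
    s = 0 ∨ ∃ i : ℕ, n = i ∧ s ∈ 𝒮 i := by
  rw [ringDeg] at hs
  split_ifs at hs with h
  · exact Or.inr ⟨n.toNat, by omega, hs⟩
  · exact Or.inl hs

theorem mul_mem_ringDeg {i : ℕ} {n : ℤ} {s t : S} (hs : s ∈ 𝒮 i) (ht : t ∈ ringDeg 𝒮 n) :
    s * t ∈ ringDeg 𝒮 (i + n) := by
  rcases ringDeg_cases ht with rfl | ⟨k, rfl, ht⟩
  · rw [mul_zero]; exact zero_mem _
  · rw [← Nat.cast_add, ringDeg_natCast]
    exact SetLike.mul_mem_graded hs ht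

theorem ringProj_eq_self {n : ℤ} {s : S} (hs : s ∈ ringDeg 𝒮 n) : ringProj 𝒮 n s = s := by
  rcases ringDeg_cases hs with rfl | ⟨i, rfl, hs⟩
  · exact map_zero _
  · exact ringProj_same hs

theorem ringProj_eq_zero {m n : ℤ} {s : S} (hs : s ∈ ringDeg 𝒮 m) (h : m ≠ n) :
    ringProj 𝒮 n s = 0 := by
  rcases ringDeg_cases hs with rfl | ⟨i, rfl, hs⟩
  · exact map_zero _
  · exact ringProj_ne hs h

theorem ringProj_mem (n : ℤ) (s : S) : ringProj 𝒮 n s ∈ ringDeg 𝒮 n := by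
  rw [ringProj, ringDeg]
  split_ifs
  · exact SetLike.coe_mem _
  · exact zero_mem _

section Residue

variable [IsLocalRing (𝒮 0)]

theorem algebraMap_resField (s : S) : algebraMap S (ResField 𝒮) s =
    IsLocalRing.residue (𝒮 0) (GradedRing.projZeroRingHom' 𝒮 s) := rfl

theorem algebraMap_resField_surjective : Function.Surjective (algebraMap S (ResField 𝒮)) := by
  intro c
  obtain ⟨s, rfl⟩ := IsLocalRing.residue_surjective (R := 𝒮 0) c
  refine ⟨s, ?_⟩
  rw [algebraMap_resField]
  congr 1
  ext
  exact DirectSum.decompose_of_mem_same 𝒮 s.2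

theorem algebraMap_resField_of_mem {i : ℕ} (hi : i ≠ 0) {s : S} (hs : s ∈ 𝒮 i) :
    algebraMap S (ResField 𝒮) s = 0 := by
  have h : GradedRing.projZeroRingHom' 𝒮 s = 0 :=
    Subtype.ext (DirectSum.decompose_of_mem_ne 𝒮 hs hi)
  rw [algebraMap_resField, h, map_zero]
  rfl

theorem algebraMap_resField_ringProj {n : ℤ} (hn : n ≠ 0) (s : S) :
    algebraMap S (ResField 𝒮) (ringProj 𝒮 n s) = 0 := by
  rcases ringDeg_cases (ringProj_mem (𝒮 := 𝒮) n s) with h | ⟨i, rfl, h⟩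
  · rw [h, map_zero]
  · exact algebraMap_resField_of_mem (by simpa using hn) h

/-- An element of the local ring `S₀` with nonzero residue is a unit. `S` itself need not be local,
which is why the component of degree zero is taken. -/
theorem isUnit_ringProj_zero {s : S} (hs : algebraMap S (ResField 𝒮) s ≠ 0) :
    IsUnit (ringProj 𝒮 0 s) := by
  have h : IsUnit (GradedRing.projZeroRingHom' 𝒮 s) := by
    by_contra h
    exact hs (Ideal.Quotient.eq_zero_iff_mem.2 ((IsLocalRing.mem_maximalIdeal _).2 h))
  have := h.map (SetLike.GradeZero.subring 𝒮).subtype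
  exact this

end Residue

namespace GrMod

variable (M : GrMod 𝒮)

theorem exists_proj : ∃ p : ℤ → M →+ M,
    (∀ j x, p j x ∈ M.deg j) ∧ (∀ j x, x ∈ M.deg j → p j x = x) ∧
    (∀ i j x, x ∈ M.deg i → i ≠ j → p j x = 0) ∧ (∀ x, ∃ s : Finset ℤ, ∑ j ∈ s, p j x = x) := by
  classical
  let _ : DirectSum.Decomposition M.deg := M.isInternal.chooseDecomposition
  exact ⟨fun j =>
    { toFun := fun x => (DirectSum.decompose M.deg x j : M)
      map_zero' := by simp
      map_add' := by intro x y; simp }, fun j x => SetLike.coe_mem _,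
    fun j x hx => DirectSum.decompose_of_mem_same M.deg hx,
    fun i j x hx hij => DirectSum.decompose_of_mem_ne M.deg hx hij,
    fun x => ⟨_, DirectSum.sum_support_decompose M.deg x⟩⟩

/-- The projection to the component of degree `j`. -/
def proj (j : ℤ) : M →+ M := M.exists_proj.choose j

theorem proj_mem (j : ℤ) (x : M) : M.proj j x ∈ M.deg j := M.exists_proj.choose_spec.1 j x

variable {M} in
theorem proj_same {j : ℤ} {x : M} (hx : x ∈ M.deg j) : M.proj j x = x :=
  M.exists_proj.choose_spec.2.1 j x hx

variable {M} in
theorem proj_ne {i j : ℤ} {x : M} (hx : x ∈ M.deg i) (h : i ≠ j) : M.proj j x = 0 :=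
  M.exists_proj.choose_spec.2.2.1 i j x hx h

theorem exists_sum_proj (x : M) : ∃ s : Finset ℤ, ∑ j ∈ s, M.proj j x = x :=
  M.exists_proj.choose_spec.2.2.2 x

variable {M} in
theorem homogeneous_induction {p : M → Prop} (h0 : p 0) (hom : ∀ j x, x ∈ M.deg j → p x)
    (hadd : ∀ x y, p x → p y → p (x + y)) (x : M) : p x := by
  obtain ⟨s, hs⟩ := M.exists_sum_proj x
  rw [← hs]
  exact Finset.sum_induction _ p hadd h0 fun j _ => hom j _ (M.proj_mem j x)

variable {M} in
theorem proj_smul {k : ℤ} {x : M} (hx : x ∈ M.deg k) (s : S) (j : ℤ) :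
    M.proj j (s • x) = ringProj 𝒮 (j - k) s • x := by
  induction s using ring_induction 𝒮 with
  | h0 => simp
  | hom i s hs =>
    by_cases h : (i : ℤ) = j - k
    · rw [← h, ringProj_same hs, proj_same]
      have := M.smul_mem hs hx
      rwa [h, sub_add_cancel] at this
    · rw [ringProj_ne hs h, zero_smul, proj_ne (M.smul_mem hs hx)]
      omega
  | hadd s t hs ht => simp [add_smul, hs, ht]

/-- A linear map of degree `a` commutes with the projections. -/
theorem map_proj {M N : GrMod 𝒮} {a : ℤ} (f : M →ₗ[S] N)
    (hf : ∀ j x, x ∈ M.deg j → f x ∈ N.deg (j + a)) (j : ℤ) (x : M) :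
    f (M.proj j x) = N.proj (j + a) (f x) := by
  induction x using homogeneous_induction with
  | h0 => simp
  | hom i x hx =>
    by_cases h : i = j
    · subst h
      rw [proj_same hx, proj_same (hf _ _ hx)]
    · rw [proj_ne hx h, map_zero, proj_ne (hf _ _ hx) (by omega)]
  | hadd x y hx hy => simp [hx, hy]

variable {M} {ι : Type*} (b : Module.Basis ι S M) {k : ι → ℤ} (hb : ∀ e, b e ∈ M.deg (k e))

-- Commuting with the homogeneous projections is additive, so it can be tested on multiples of basis
-- elements, where `proj_smul` computes both sides.
include hb in
theorem map_mem_of_basis {N : GrMod 𝒮} {a : ℤ} (f : M →ₗ[S] N)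
    (hf : ∀ e, f (b e) ∈ N.deg (k e + a)) {j : ℤ} {x : M} (hx : x ∈ M.deg j) :
    f x ∈ N.deg (j + a) := by
  have key : ∀ x : M, f (M.proj j x) = N.proj (j + a) (f x) := by
    intro x
    induction x using basis_induction b with
    | h0 => simp
    | hadd x y hx hy => simp [hx, hy]
    | hsmul c e =>
      rw [proj_smul (hb e), map_smul, map_smul, proj_smul (hf e)]
      congr 2
      ring_nf
  rw [← proj_same hx, key]
  exact N.proj_mem _ _

include hb in
theorem repr_proj (j : ℤ) (x : M) (e : ι) :
    b.repr (M.proj j x) e = ringProj 𝒮 (j - k e) (b.repr x e) := by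
  classical
  induction x using basis_induction b with
  | h0 => simp
  | hadd x y hx hy => simp [hx, hy]
  | hsmul c e' =>
    rw [proj_smul (hb e')]
    by_cases h : e' = e
    · subst h
      simp
    · simp [h]

include hb in
/-- The coefficients of a homogeneous element with respect to a homogeneous basis are non-units,
except for those of degree `0`. -/
theorem algebraMap_repr_eq_zero [IsLocalRing (𝒮 0)] {j : ℤ} {x : M} (hx : x ∈ M.deg j) {e : ι}
    (h : j ≠ k e) : algebraMap S (ResField 𝒮) (b.repr x e) = 0 := by
  rw [← proj_same hx, repr_proj b hb]
  exact algebraMap_resField_ringProj (sub_ne_zero.2 h) _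

end GrMod

end GradedRings

/-! ### The total Betti number as the rank of any minimal homotopy projective resolution -/

section TotalBetti

variable {S : Type u} [CommRing S] {𝒮 : ℕ → AddSubgroup S} [GradedRing 𝒮] [IsLocalRing (𝒮 0)]

/-- In the expansion of an element of degree `j`, the coefficients at basis elements of other
degrees have nonzero degree and die in `𝕜`. -/
theorem GrMod.fiberDeg_eq_span {M : GrMod 𝒮} {ι : Type*} (b : Module.Basis ι S M) {k : ι → ℤ}
    (hb : ∀ e, b e ∈ M.deg (k e)) (j : ℤ) :
    M.fiberDeg j = Submodule.span (ResField 𝒮)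
      (Set.range fun e : {e // k e = j} => b.baseChange (ResField 𝒮) e) := by
  apply le_antisymm
  · refine Submodule.span_le.2 ?_
    rintro _ ⟨x, hx, rfl⟩
    rw [← b.linearCombination_repr x, Finsupp.linearCombination_apply, Finsupp.sum,
      TensorProduct.tmul_sum]
    refine Submodule.sum_mem _ fun e _ => ?_
    rw [← TensorProduct.smul_tmul, Algebra.smul_def, mul_one]
    by_cases h : k e = j
    · have h1 : algebraMap S (ResField 𝒮) (b.repr x e) ⊗ₜ[S] b e =
          algebraMap S (ResField 𝒮) (b.repr x e) • b.baseChange (ResField 𝒮) e := by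
        rw [Module.Basis.baseChange_apply, TensorProduct.smul_tmul', smul_eq_mul, mul_one]
      rw [h1]
      exact Submodule.smul_mem _ _ (Submodule.subset_span ⟨⟨e, h⟩, rfl⟩)
    · rw [GrMod.algebraMap_repr_eq_zero b hb hx (Ne.symm h), TensorProduct.zero_tmul]
      exact Submodule.zero_mem _
  · refine Submodule.span_le.2 ?_
    rintro _ ⟨⟨e, rfl⟩, rfl⟩
    exact Submodule.subset_span ⟨b e, hb e, Module.Basis.baseChange_apply _ _ _⟩

theorem rank_classesOf_zero {R V : Type u} [Field R] [AddCommGroup V] [Module R V]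
    (N : Submodule R V) :
    Module.rank R (EndHomology.classesOf (0 : V →ₗ[R] V) N) = Module.rank R N := by
  have hinj : Function.Injective ((LinearMap.range (0 : V →ₗ[R] V)).submoduleOf
      (LinearMap.ker (0 : V →ₗ[R] V))).mkQ := by
    rw [← LinearMap.ker_eq_bot, Submodule.ker_mkQ, LinearMap.range_zero, Submodule.submoduleOf,
      Submodule.comap_bot, Submodule.ker_subtype]
  have e1 := (Submodule.equivMapOfInjective _ hinj
    (N.submoduleOf (LinearMap.ker (0 : V →ₗ[R] V)))).rank_eq
  have e2 := (Submodule.submoduleOfEquivOfLe (p := N) (q := LinearMap.ker (0 : V →ₗ[R] V))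
    (by simp)).rank_eq
  exact e1.symm.trans e2

/-- By minimality nothing is lost on passing to homology, so the dimension in degree `j` counts
basis elements of degree `j`, and the fibres of the degree function partition the basis. -/
theorem DM.sum_fiberHomologyDim {a : ℤ} (G : DM 𝒮 a) (hfree : G.toGrMod.IsGradedFree ⊤)
    (hmin : G.IsMinimal) :
    Cardinal.sum G.fiberHomologyDim = Module.rank (ResField 𝒮) (ResField 𝒮 ⊗[S] G) := by
  obtain ⟨ι, b', hb'⟩ := hfree
  choose k hk using hb'
  let b : Module.Basis ι S G.toGrMod := b'.map Submodule.topEquiv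
  have hb : ∀ e, b e ∈ G.deg (k e) := hk
  have hdim : ∀ j, G.fiberHomologyDim j = Cardinal.mk {e // k e = j} := by
    intro j
    have h0 : G.fiberD = 0 := hmin
    rw [DM.fiberHomologyDim, h0, rank_classesOf_zero, GrMod.fiberDeg_eq_span b hb]
    exact rank_span ((b.baseChange (ResField 𝒮)).linearIndependent.comp _
      Subtype.val_injective) |>.trans (Cardinal.mk_range_eq _
      ((b.baseChange (ResField 𝒮)).injective.comp Subtype.val_injective))
  have hsum : Cardinal.sum G.fiberHomologyDim = Cardinal.mk ι := by
    rw [funext hdim, ← Cardinal.mk_sigma]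
    exact Cardinal.mk_congr (Equiv.sigmaFiberEquiv k)
  rw [hsum, (b.baseChange (ResField 𝒮)).mk_eq_rank'']

theorem DM.Hom.isQuis {a : ℤ} {D E : DM 𝒮 a} {φ : DM.Hom D E} (h : φ.IsQuasiIso) :
    IsQuis D.d E.d φ.f where
  comm := φ.comm
  inj x hx := by
    rintro ⟨y, hy⟩
    have h1 : φ.homologyMap (Submodule.Quotient.mk ⟨x, hx⟩) = 0 :=
      (Submodule.Quotient.mk_eq_zero _).2 ⟨y, hy⟩
    have h2 := h.1 (h1.trans (map_zero _).symm)
    obtain ⟨x', hx'⟩ := (Submodule.Quotient.mk_eq_zero _).1 h2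
    exact ⟨x', hx'⟩
  surj y hy := by
    obtain ⟨z, hz⟩ := h.2 (Submodule.Quotient.mk ⟨y, hy⟩)
    obtain ⟨⟨x, hx⟩, rfl⟩ := Submodule.Quotient.mk_surjective _ z
    obtain ⟨w, hw⟩ := (Submodule.Quotient.eq _).1 hz
    refine ⟨x, -w, hx, ?_⟩
    have hw' : E.d w = φ.f x - y := hw
    rw [map_neg, hw']
    abel

/-- The internal decomposition transports the differential to an external direct sum of free
modules, where `isHomotopyProjective_directSum` applies. -/
theorem DM.IsFreeFlag.isHomotopyProjective {a : ℤ} {D : DM 𝒮 a} (h : D.IsFreeFlag) :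
    IsHomotopyProjective D.d := by
  classical
  obtain ⟨F, hF, hfree, hd⟩ := h
  have : ∀ i, Module.Projective S (F i) := fun i => by
    obtain ⟨ι, b, -⟩ := hfree i
    exact Module.Projective.of_basis b
  let e : (DirectSum ℕ fun i => F i) ≃ₗ[S] D :=
    LinearEquiv.ofBijective (DirectSum.coeLinearMap F) hF
  have he : ∀ i x, e (DirectSum.lof S ℕ (fun i => F i) i x) = x := fun i x =>
    DirectSum.coeLinearMap_lof F i x
  have hsupp : ∀ i, ⨆ j, ⨆ _ : j < i, F j ≤
      (supportedBelow (S := S) (fun i => F i) i).comap e.symm.toLinearMap := by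
    intro i
    refine iSup_le fun j => iSup_le fun hj x hx => ?_
    have : e.symm x = DirectSum.lof S ℕ (fun i => F i) j ⟨x, hx⟩ := by
      rw [LinearEquiv.symm_apply_eq, he]
    rw [Submodule.mem_comap, LinearEquiv.coe_coe, this]
    exact lof_mem_supportedBelow hj _
  refine (isHomotopyProjective_directSum (P := fun i => F i)
    (e.symm.toLinearMap ∘ₗ D.d ∘ₗ e.toLinearMap) (fun x => by simp [D.d_d]) fun i x => ?_).of_retract
    e.symm.toLinearMap e.toLinearMap (fun x => by simp) (fun x => by simp) (fun x => by simp)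
  have := hsupp i (hd i x x.2)
  simpa [he] using this

theorem DM.IsMinFreeRes.isHomotopyProjective {a : ℤ} {G D : DM 𝒮 a} (h : G.IsMinFreeRes D) :
    IsHomotopyProjective G.d := by
  obtain ⟨-, -, F, i, r, -, -, hF, -, -, hri, -⟩ := h
  exact hF.isHomotopyProjective.of_retract i.f r.f i.comm r.comm hri

/-- The total Betti number of `D` is the rank of every minimal homotopy projective resolution. -/
theorem DM.HasTotalBetti.eq_rank {a : ℤ} {D : DM 𝒮 a} {c : Cardinal.{u}} (h : D.HasTotalBetti c)
    {F : Type u} [AddCommGroup F] [Module S F] {d : F →ₗ[S] F} (hdd : ∀ x, d (d x) = 0)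
    (hF : IsHomotopyProjective d) (hmin : d.baseChange (ResField 𝒮) = 0) {ε : F →ₗ[S] D}
    (hε : IsQuis d D.d ε) : c = Module.rank (ResField 𝒮) (ResField 𝒮 ⊗[S] F) := by
  obtain ⟨G, hG, rfl⟩ := h
  have hGP := hG.isHomotopyProjective
  obtain ⟨hfree, hGmin, -, -, -, -, η, -, -, hη, -⟩ := hG
  rw [G.sum_fiberHomologyDim hfree hGmin]
  obtain ⟨u, v, s, t, hs, ht⟩ :=
    (DM.Hom.isQuis hη).exists_homotopy_inverse hε G.d_d hdd D.d_d hGP hF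
  exact rank_baseChange_eq_of_homotopy (ResField 𝒮) hGmin hmin u v s t hs ht

end TotalBetti

/-! ### Graded Nakayama and existence of minimal graded free resolutions -/

section MinimalResolutions

variable {S : Type u} [CommRing S] {𝒮 : ℕ → AddSubgroup S} [GradedRing 𝒮]

namespace GrMod

section Local

variable [IsLocalRing (𝒮 0)]

/-- Since `S → 𝕜` is surjective with kernel `I`, the fibre `𝕜 ⊗ A` is `A / I A`. -/
theorem mem_smul_top_of_tmul_eq_zero {A : Type u} [AddCommGroup A] [Module S A] {x : A}
    (hx : (1 : ResField 𝒮) ⊗ₜ[S] x = 0) :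
    x ∈ RingHom.ker (algebraMap S (ResField 𝒮)) • (⊤ : Submodule S A) := by
  let e : (S ⧸ RingHom.ker (Algebra.ofId S (ResField 𝒮))) ≃ₐ[S] ResField 𝒮 :=
    Ideal.quotientKerAlgEquivOfSurjective (f := Algebra.ofId S (ResField 𝒮))
      algebraMap_resField_surjective
  have h := congrArg ((TensorProduct.quotTensorEquivQuotSMul A
    (RingHom.ker (Algebra.ofId S (ResField 𝒮)))).toLinearMap ∘ₗ
      TensorProduct.map e.symm.toLinearMap LinearMap.id) hx
  have h1 : e.symm.toLinearMap (1 : ResField 𝒮) = Ideal.Quotient.mk _ 1 := map_one e.symm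
  rw [LinearMap.comp_apply, TensorProduct.map_tmul, h1, map_zero, LinearMap.id_apply,
    LinearEquiv.coe_coe, TensorProduct.quotTensorEquivQuotSMul_mk_tmul, one_smul,
    Submodule.Quotient.mk_eq_zero] at h
  exact h

variable {M : GrMod 𝒮}

/-- Graded Nakayama lemma. -/
theorem span_eq_top_of_homogeneous [Module.Finite S M] {ι : Type*} {m : ι → M} {k : ι → ℤ}
    (hm : ∀ e, m e ∈ M.deg (k e))
    (hspan : Submodule.span (ResField 𝒮) (Set.range fun e => (1 : ResField 𝒮) ⊗ₜ[S] m e) = ⊤) :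
    Submodule.span S (Set.range m) = ⊤ := by
  set N := Submodule.span S (Set.range m) with hN
  have hproj : ∀ x ∈ N, ∀ j, M.proj j x ∈ N := by
    intro x hx j
    induction hx using Submodule.closure_induction with
    | zero => simp
    | add x y _ _ hx hy => rw [map_add]; exact add_mem hx hy
    | smul_mem c x hx =>
      obtain ⟨e, rfl⟩ := hx
      rw [proj_smul (hm e)]
      exact N.smul_mem _ (Submodule.subset_span ⟨e, rfl⟩)
  have hsup : (⊤ : Submodule S M) ≤ N ⊔ RingHom.ker (algebraMap S (ResField 𝒮)) • ⊤ := by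
    intro x _
    have hx : (1 : ResField 𝒮) ⊗ₜ[S] x ∈
        Submodule.span (ResField 𝒮) (Set.range fun e => (1 : ResField 𝒮) ⊗ₜ[S] m e) := by
      rw [hspan]; trivial
    obtain ⟨c, hc⟩ := (Finsupp.mem_span_range_iff_exists_finsupp).1 hx
    choose s hs using algebraMap_resField_surjective (𝒮 := 𝒮)
    have h1 : (1 : ResField 𝒮) ⊗ₜ[S] (x - c.sum fun e a => s a • m e) = 0 := by
      rw [TensorProduct.tmul_sub, ← hc, Finsupp.sum, Finsupp.sum, TensorProduct.tmul_sum,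
        sub_eq_zero]
      refine Finset.sum_congr rfl fun e _ => ?_
      rw [← TensorProduct.smul_tmul, Algebra.smul_def, mul_one, hs, TensorProduct.smul_tmul',
        smul_eq_mul, mul_one]
    rw [← add_sub_cancel (c.sum fun e a => s a • m e) x]
    refine Submodule.add_mem_sup (Submodule.sum_mem _ fun e _ => ?_)
      (mem_smul_top_of_tmul_eq_zero h1)
    exact N.smul_mem _ (Submodule.subset_span ⟨e, rfl⟩)
  -- General Nakayama only gives `r` congruent to `1` with `r M ⊆ N`, and `r` need not be a unit. As
  -- `N` is stable under the projections, the degree-zero component of `r`, which is a unit, also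
  -- multiplies homogeneous elements into `N`.
  obtain ⟨r, hr, hrN⟩ := Submodule.exists_sub_one_mem_and_smul_le_of_fg_of_le_sup
    (Module.Finite.fg_top (R := S) (M := M)) le_rfl hsup
  rw [RingHom.mem_ker, map_sub, map_one, sub_eq_zero] at hr
  have hu : IsUnit (ringProj 𝒮 0 r) := isUnit_ringProj_zero (by rw [hr]; exact one_ne_zero)
  rw [eq_top_iff]
  intro x _
  induction x using homogeneous_induction with
  | h0 => exact zero_mem _
  | hadd x y hx hy => exact add_mem (hx trivial) (hy trivial)
  | hom j x hx =>
    have h1 : r • x ∈ N := hrN (Submodule.smul_mem_pointwise_smul x r ⊤ trivial)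
    have h2 := hproj _ h1 j
    rw [proj_smul hx, sub_self] at h2
    exact (Submodule.smul_mem_iff_of_isUnit N hu).1 h2

variable (M) in
/-- A minimal system of homogeneous generators. -/
theorem exists_minimal_generators [Module.Finite S M] :
    ∃ (r : ℕ) (m : Fin r → M) (k : Fin r → ℤ), (∀ e, m e ∈ M.deg (k e)) ∧
      LinearIndependent (ResField 𝒮) (fun e => (1 : ResField 𝒮) ⊗ₜ[S] m e) ∧
      Submodule.span S (Set.range m) = ⊤ := by
  let T : Set (ResField 𝒮 ⊗[S] M) := {t | ∃ j, ∃ x ∈ M.deg j, t = 1 ⊗ₜ[S] x}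
  have hT : Submodule.span (ResField 𝒮) T = ⊤ := by
    rw [eq_top_iff]
    rintro t -
    induction t using TensorProduct.induction_on with
    | zero => exact zero_mem _
    | add x y hx hy => exact add_mem hx hy
    | tmul c x =>
      rw [← mul_one c, ← smul_eq_mul, ← TensorProduct.smul_tmul']
      refine Submodule.smul_mem _ _ ?_
      induction x using homogeneous_induction with
      | h0 => rw [TensorProduct.tmul_zero]; exact zero_mem _
      | hadd x y hx hy => rw [TensorProduct.tmul_add]; exact add_mem hx hy
      | hom j x hx => exact Submodule.subset_span ⟨j, x, hx, rfl⟩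
  -- A basis of the fibre is extracted from the images of homogeneous elements, so that its members
  -- lift to homogeneous generators.
  obtain ⟨B, hBT, hspan, hli⟩ := exists_linearIndependent (ResField 𝒮) T
  have hfin : Finite B := hli.finite
  obtain ⟨r, ⟨f⟩⟩ := Finite.exists_equiv_fin B
  have hB : ∀ e : Fin r, ∃ (j : ℤ) (x : M), x ∈ M.deg j ∧
      (f.symm e : ResField 𝒮 ⊗[S] M) = 1 ⊗ₜ[S] x := fun e => by
    obtain ⟨j, x, hx, h⟩ := hBT (f.symm e).2
    exact ⟨j, x, hx, h⟩
  choose k m hm hfm using hB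
  have hfun : (fun e => (1 : ResField 𝒮) ⊗ₜ[S] m e) = Subtype.val ∘ f.symm :=
    funext fun e => (hfm e).symm
  refine ⟨r, m, k, hm, ?_, span_eq_top_of_homogeneous hm ?_⟩
  · rw [hfun]
    exact hli.comp _ f.symm.injective
  · rw [hfun, Set.range_comp, f.symm.surjective.range_eq, Set.image_univ, Subtype.range_val,
      hspan, hT]

end Local

variable (𝒮) in
/-- The graded free module `⨁ S(-k e)`. -/
def free {r : ℕ} (k : Fin r → ℤ) : GrMod 𝒮 where
  carrier := Fin r → S
  deg j := ⨅ e, (ringDeg 𝒮 (j - k e)).comap (Pi.evalAddMonoidHom (fun _ => S) e)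
  isInternal := by
    classical
    refine isInternal_of_proj _ (fun j => AddMonoidHom.piMap fun e => ringProj 𝒮 (j - k e))
      (fun j x hx => ?_) (fun i j x hx hij => ?_) fun x => ?_
    · ext e
      exact ringProj_eq_self ((AddSubgroup.mem_iInf.1 hx) e)
    · ext e
      exact ringProj_eq_zero ((AddSubgroup.mem_iInf.1 hx) e) (by omega)
    · rw [← Finset.univ_sum_single x]
      refine sum_mem fun e _ => ?_
      induction x e using ring_induction 𝒮 with
      | h0 => rw [Pi.single_zero]; exact zero_mem _
      | hadd s t hs ht => rw [Pi.single_add]; exact add_mem hs ht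
      | hom i s hs =>
        refine AddSubgroup.mem_iSup_of_mem ((i : ℤ) + k e) (AddSubgroup.mem_iInf.2 fun e' => ?_)
        rw [AddSubgroup.mem_comap, Pi.evalAddMonoidHom_apply]
        by_cases h : e' = e
        · subst h
          rwa [Pi.single_eq_same, add_sub_cancel_right, ringDeg_natCast]
        · rw [Pi.single_eq_of_ne h]
          exact zero_mem _
  smul_mem := by
    intro i j s x hs hx
    refine AddSubgroup.mem_iInf.2 fun e => ?_
    have := mul_mem_ringDeg hs ((AddSubgroup.mem_iInf.1 hx) e)
    rwa [← add_sub_assoc] at this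

variable (𝒮) in
/-- The standard basis of `⨁ S(-k e)`. -/
def freeBasis {r : ℕ} (k : Fin r → ℤ) : Module.Basis (Fin r) S (free 𝒮 k) := Pi.basisFun S (Fin r)

theorem freeBasis_mem {r : ℕ} (k : Fin r → ℤ) (e : Fin r) :
    freeBasis 𝒮 k e ∈ (free 𝒮 k).deg (k e) := by
  classical
  refine AddSubgroup.mem_iInf.2 fun e' => ?_
  have h : freeBasis 𝒮 k e = Pi.single e (1 : S) := Pi.basisFun_apply S (Fin r) e
  change (freeBasis 𝒮 k e : Fin r → S) e' ∈ ringDeg 𝒮 (k e - k e')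
  rw [h]
  by_cases h : e' = e
  · subst h
    rw [Pi.single_eq_same, sub_self]
    exact (ringDeg_natCast (𝒮 := 𝒮) 0).symm ▸ SetLike.one_mem_graded 𝒮
  · rw [Pi.single_eq_of_ne h]
    exact zero_mem _

/-- The kernel of a homogeneous map of degree `0`, as a graded module. -/
def ker {M N : GrMod 𝒮} (f : M →ₗ[S] N) (hf : ∀ j x, x ∈ M.deg j → f x ∈ N.deg j) :
    GrMod 𝒮 where
  carrier := LinearMap.ker f
  deg j := (M.deg j).comap (LinearMap.ker f).subtype.toAddMonoidHom
  isInternal := by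
    have hp : ∀ j (x : LinearMap.ker f), f (M.proj j x) = 0 := fun j x => by
      rw [map_proj (a := 0) f (by simpa using hf), LinearMap.mem_ker.1 x.2, map_zero]
    refine isInternal_of_proj _ (fun j =>
      { toFun := fun x => ⟨M.proj j x, hp j x⟩
        map_zero' := by ext; simp
        map_add' := fun x y => by ext; simp })
      (fun j x hx => Subtype.ext (proj_same hx))
      (fun i j x hx hij => Subtype.ext (proj_ne hx hij)) fun x => ?_
    obtain ⟨s, hs⟩ := M.exists_sum_proj x
    have : x = ∑ j ∈ s, (⟨M.proj j x, hp j x⟩ : LinearMap.ker f) := by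
      ext
      simpa using hs.symm
    rw [this]
    exact sum_mem fun j _ => AddSubgroup.mem_iSup_of_mem j (M.proj_mem j x)
  smul_mem hs hx := M.smul_mem hs hx

variable [IsLocalRing (𝒮 0)]

/-- The data of a minimal graded free cover `P → M`. -/
structure Cover (M : GrMod 𝒮) where
  rank : ℕ
  shift : Fin rank → ℤ
  aug : free 𝒮 shift →ₗ[S] M
  aug_mem : ∀ j x, x ∈ (free 𝒮 shift).deg j → aug x ∈ M.deg j
  surjective : Function.Surjective aug
  minimal : ∀ x, aug x = 0 → (1 : ResField 𝒮) ⊗ₜ[S] x = 0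

/-- For minimality: a relation among the generators reduces to a linear relation among independent
vectors of the fibre, so all its coefficients vanish in `𝕜`. -/
theorem nonempty_cover (M : GrMod 𝒮) [Module.Finite S M] : Nonempty M.Cover := by
  obtain ⟨r, m, k, hm, hli, hspan⟩ := M.exists_minimal_generators
  let aug : free 𝒮 k →ₗ[S] M := (freeBasis 𝒮 k).constr ℕ m
  have haug : ∀ e, aug (freeBasis 𝒮 k e) = m e := fun e => (freeBasis 𝒮 k).constr_basis ℕ m e
  refine ⟨⟨r, k, aug, fun j x hx => ?_, ?_, fun x hx => ?_⟩⟩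
  · have := map_mem_of_basis (a := 0) (freeBasis 𝒮 k) (freeBasis_mem k) aug
      (fun e => by rw [haug, add_zero]; exact hm e) hx
    rwa [add_zero] at this
  · rw [← LinearMap.range_eq_top, Module.Basis.constr_range, hspan]
  · have hsum := (freeBasis 𝒮 k).sum_repr x
    have h1 : ∑ e, algebraMap S (ResField 𝒮) ((freeBasis 𝒮 k).repr x e) •
        ((1 : ResField 𝒮) ⊗ₜ[S] m e) = 0 := by
      have := congrArg (fun y => (1 : ResField 𝒮) ⊗ₜ[S] y) hx
      rw [← hsum, map_sum, TensorProduct.tmul_sum, TensorProduct.tmul_zero] at this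
      rw [← this]
      refine Finset.sum_congr rfl fun e _ => ?_
      rw [map_smul, haug, ← TensorProduct.smul_tmul, Algebra.smul_def, TensorProduct.smul_tmul',
        smul_eq_mul]
    have h2 := Fintype.linearIndependent_iff.1 hli _ h1
    rw [← hsum, TensorProduct.tmul_sum]
    refine Finset.sum_eq_zero fun e _ => ?_
    rw [← TensorProduct.smul_tmul, Algebra.smul_def, h2, zero_mul, TensorProduct.zero_tmul]

variable [IsNoetherianRing S]

/-- A minimal graded free cover of a finitely generated graded module. -/
def cover (M : {M : GrMod 𝒮 // Module.Finite S M}) : M.1.Cover :=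
  have := M.2
  M.1.nonempty_cover.some

/-- The syzygy module. -/
def syzygy (M : {M : GrMod 𝒮 // Module.Finite S M}) : {M : GrMod 𝒮 // Module.Finite S M} :=
  ⟨ker (cover M).aug (cover M).aug_mem, by
    have : Module.Finite S (free 𝒮 (cover M).shift) :=
      Module.Finite.of_basis (freeBasis 𝒮 (cover M).shift)
    exact inferInstanceAs (Module.Finite S (LinearMap.ker (cover M).aug))⟩

/-- The iterated syzygy modules. -/
def syzygies (M : {M : GrMod 𝒮 // Module.Finite S M}) (n : ℕ) :
    {M : GrMod 𝒮 // Module.Finite S M} :=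
  Nat.rec M (fun _ => syzygy) n

/-- The inclusion of a syzygy module. -/
def syzygyIncl (M : {M : GrMod 𝒮 // Module.Finite S M}) :
    (syzygy M).1 →ₗ[S] free 𝒮 (cover M).shift :=
  (LinearMap.ker (cover M).aug).subtype

/-- Minimal covers of the successive syzygies are spliced together; `S` being Noetherian keeps the
syzygies finitely generated. The image of each differential lies in the kernel of a minimal cover,
whence minimality. -/
theorem nonempty_minFreeRes (M : GrMod 𝒮) (hM : Module.Finite S M) : Nonempty M.MinFreeRes := by
  let K := syzygies ⟨M, hM⟩
  let d : ∀ i, free 𝒮 (cover (K (i + 1))).shift →ₗ[S] free 𝒮 (cover (K i)).shift := fun i =>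
    syzygyIncl (K i) ∘ₗ (cover (K (i + 1))).aug
  have hd : ∀ i y, d i y = syzygyIncl (K i) ((cover (K (i + 1))).aug y) := fun _ _ => rfl
  have hinj : ∀ i, Function.Injective (syzygyIncl (K i)) := fun i => Subtype.val_injective
  have hexact : ∀ i, Function.Exact (d i) (cover (K i)).aug := by
    intro i x
    constructor
    · intro hx
      obtain ⟨y, hy⟩ := (cover (K (i + 1))).surjective (⟨x, hx⟩ : LinearMap.ker (cover (K i)).aug)
      exact ⟨y, (hd i y).trans (congrArg (syzygyIncl (K i)) hy)⟩
    · rintro ⟨y, rfl⟩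
      exact ((cover (K (i + 1))).aug y : LinearMap.ker (cover (K i)).aug).2
  refine ⟨{
    P := fun i => free 𝒮 (cover (K i)).shift
    rank := fun i => (cover (K i)).rank
    basis := fun i => freeBasis 𝒮 _
    shift := fun i => (cover (K i)).shift
    basis_mem := fun i => freeBasis_mem _
    d := d
    d_mem := fun i j x hx => (cover (K (i + 1))).aug_mem j x hx
    aug := (cover (K 0)).aug
    aug_mem := (cover (K 0)).aug_mem
    aug_surjective := (cover (K 0)).surjective
    exact_zero := hexact 0
    exact_succ := fun i x => ?_
    minimal := fun i => ?_ }⟩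
  · rw [← hexact (i + 1) x, hd]
    exact ⟨fun h => hinj i (h.trans (map_zero _).symm), fun h =>
      (congrArg (syzygyIncl (K i)) h).trans (map_zero _)⟩
  · refine TensorProduct.AlgebraTensorModule.ext fun c x => ?_
    have h := (cover (K i)).minimal (d i x) ((hexact i _).2 ⟨x, rfl⟩)
    rw [LinearMap.baseChange_tmul, ← mul_one c, ← smul_eq_mul, ← TensorProduct.smul_tmul', h,
      smul_zero]
    rfl

end GrMod

end MinimalResolutions

/-! ### Partial flags over a resolution and their correction terms -/

section PartialFlags

open DirectSum

theorem sub_mem_supportedBelow {S : Type u} [CommRing S] {P : ℕ → Type u}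
    [∀ i, AddCommGroup (P i)] [∀ i, Module S (P i)] {n : ℕ} {s t : ⨁ i, P i}
    (hs : s ∈ supportedBelow (S := S) P (n + 1)) (ht : t ∈ supportedBelow (S := S) P (n + 1))
    (h : s n = t n) : s - t ∈ supportedBelow (S := S) P n := by
  intro m hm
  rw [DirectSum.sub_apply]
  rcases Nat.eq_or_lt_of_le hm with rfl | hm
  · rw [h, sub_self]
  · rw [hs m hm, ht m hm, sub_zero]

variable {S : Type u} [CommRing S] {𝒮 : ℕ → AddSubgroup S} [GradedRing 𝒮] [IsLocalRing (𝒮 0)]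
  {M : GrMod 𝒮}

namespace GrMod.MinFreeRes

variable (R : M.MinFreeRes)

/-- The terms of a resolution. -/
abbrev term (i : ℕ) : Type u := (R.P i).carrier

/-- The direct sum of the terms of a resolution, the `i`-th one being twisted by `a * i`. -/
abbrev total (a : ℤ) : GrMod 𝒮 where
  carrier := ⨁ i, R.term i
  -- With this twist a degree-preserving map `P (i + 1) → P i` raises the total degree by `a`, as a
  -- differential of degree `a` must.
  deg j := ⨅ m : ℕ, ((R.P m).deg (j + a * m)).comap (component S ℕ R.term m).toAddMonoidHom
  isInternal := by
    refine isInternal_of_proj _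
      (fun j => DFinsupp.mapRange.addMonoidHom fun m => (R.P m).proj (j + a * m))
      (fun j x hx => ?_) (fun i j x hx hij => ?_) fun x => ?_
    · refine DFinsupp.ext fun m => ?_
      exact proj_same ((AddSubgroup.mem_iInf.1 hx) m)
    · refine DFinsupp.ext fun m => ?_
      exact proj_ne ((AddSubgroup.mem_iInf.1 hx) m) (by omega)
    · induction x using DirectSum.induction_on with
      | zero => exact zero_mem _
      | add x y hx hy => exact add_mem hx hy
      | of i x =>
        induction x using homogeneous_induction with
        | h0 => rw [map_zero]; exact zero_mem _
        | hadd x y hx hy => rw [map_add]; exact add_mem hx hy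
        | hom j x hx =>
          refine AddSubgroup.mem_iSup_of_mem (j - a * i) (AddSubgroup.mem_iInf.2 fun m => ?_)
          change of R.term i x m ∈ (R.P m).deg (j - a * i + a * m)
          by_cases h : i = m
          · subst h
            rwa [of_eq_same, sub_add_cancel]
          · rw [of_eq_of_ne _ _ _ (Ne.symm h)]
            exact zero_mem _
  smul_mem := by
    intro i j s x hs hx
    refine AddSubgroup.mem_iInf.2 fun m => ?_
    have := (R.P m).smul_mem hs ((AddSubgroup.mem_iInf.1 hx) m)
    rwa [← add_assoc] at this

variable {R} {a : ℤ}

theorem mem_total_deg {j : ℤ} {t : ⨁ i, R.term i} :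
    t ∈ (R.total a).deg j ↔ ∀ m : ℕ, t m ∈ (R.P m).deg (j + a * m) := AddSubgroup.mem_iInf

theorem lof_mem_total_deg {i : ℕ} {j : ℤ} {x : R.term i} (hx : x ∈ (R.P i).deg (j + a * i)) :
    lof S ℕ R.term i x ∈ (R.total a).deg j := by
  refine mem_total_deg.2 fun m => ?_
  rw [lof_eq_of]
  by_cases h : i = m
  · subst h
    rwa [of_eq_same]
  · rw [of_eq_of_ne _ _ _ (Ne.symm h)]
    exact zero_mem _

theorem total_proj_apply (j : ℤ) (t : ⨁ i, R.term i) (m : ℕ) :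
    ((R.total a).proj j t : ⨁ i, R.term i) m = (R.P m).proj (j + a * m) (t m) :=
  map_proj (M := R.total a) (N := R.P m) (component S ℕ R.term m)
    (fun _ _ hx => mem_total_deg.1 hx m) j t

theorem proj_mem_supportedBelow {n : ℕ} {t : ⨁ i, R.term i}
    (ht : t ∈ supportedBelow (S := S) R.term n) (j : ℤ) :
    (R.total a).proj j t ∈ supportedBelow (S := S) R.term n := fun m hm => by
  rw [total_proj_apply, ht m hm, map_zero]

variable (R a) in
/-- The homogeneous basis of the direct sum of the terms of a resolution. -/
def totalBasis : Module.Basis (Σ i, Fin (R.rank i)) S (⨁ i, R.term i) :=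
  DFinsupp.basis R.basis

theorem totalBasis_repr (t : ⨁ i, R.term i) (i : ℕ) (e : Fin (R.rank i)) :
    R.totalBasis.repr t ⟨i, e⟩ = (R.basis i).repr (t i) e := rfl

theorem totalBasis_apply (i : ℕ) (e : Fin (R.rank i)) :
    R.totalBasis ⟨i, e⟩ = lof S ℕ R.term i (R.basis i e) := by
  classical
  refine R.totalBasis.repr.injective (Finsupp.ext fun ⟨j, e'⟩ => ?_)
  rw [Module.Basis.repr_self, totalBasis_repr]
  by_cases h : i = j
  · subst h
    rw [lof_apply, Module.Basis.repr_self]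
    by_cases he : e = e'
    · subst he; simp
    · rw [Finsupp.single_eq_of_ne (Ne.symm he), Finsupp.single_eq_of_ne (by simpa using Ne.symm he)]
  · rw [lof_eq_of, of_eq_of_ne _ _ _ (Ne.symm h), map_zero,
      Finsupp.single_eq_of_ne fun h' => h (congrArg Sigma.fst h').symm]
    rfl

theorem totalBasis_mem (p : Σ i, Fin (R.rank i)) :
    R.totalBasis p ∈ (R.total a).deg (R.shift p.1 p.2 - a * p.1) := by
  obtain ⟨i, e⟩ := p
  rw [totalBasis_apply]
  refine lof_mem_total_deg ?_
  rw [sub_add_cancel]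
  exact R.basis_mem i e

variable {D : DM 𝒮 a}

/-- `d` and `ε` are the differential of a flag structure on the direct sum of the terms of the
resolution and an augmentation to `D`, such that `d` extends the first `N` maps of the resolution
and `ε` lifts the augmentation `η` of the resolution. -/
structure IsPartialFlag (R : M.MinFreeRes) (D : DM 𝒮 a) (η : R.P 0 →ₗ[S] D.homology) (N : ℕ)
    (d : (⨁ i, R.term i) →ₗ[S] ⨁ i, R.term i) (ε : (⨁ i, R.term i) →ₗ[S] D) : Prop where
  flag : ∀ i x, d (lof S ℕ R.term i x) ∈ supportedBelow (S := S) R.term i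
  leading : ∀ i < N, ∀ x, d (lof S ℕ R.term (i + 1) x) i = R.d i x
  d_d : ∀ t, d (d t) = 0
  comm : ∀ t, ε (d t) = D.d (ε t)
  d_mem : ∀ j t, t ∈ (R.total a).deg j → d t ∈ (R.total a).deg (j + a)
  aug_mem : ∀ j t, t ∈ (R.total a).deg j → ε t ∈ D.deg j
  lifts : ∀ x, ∃ hz : D.d (ε (lof S ℕ R.term 0 x)) = 0,
    (Submodule.Quotient.mk ⟨ε (lof S ℕ R.term 0 x), hz⟩ : D.H) = η x

variable {η : R.P 0 →ₗ[S] D.homology} {N : ℕ} {d : (⨁ i, R.term i) →ₗ[S] ⨁ i, R.term i}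
  {ε : (⨁ i, R.term i) →ₗ[S] D}

namespace IsPartialFlag

variable (hp : IsPartialFlag R D η N d ε)

include hp

theorem map_mem_supportedBelow {n : ℕ} {t : ⨁ i, R.term i}
    (ht : t ∈ supportedBelow (S := S) R.term (n + 1)) :
    d t ∈ supportedBelow (S := S) R.term n := by
  intro m hm
  exact eqOn_supportedBelow (f := component S ℕ R.term m ∘ₗ d) (g := 0)
    (fun i hi x => hp.flag i x m (by omega)) ht

theorem map_apply {k : ℕ} (hk : k < N) {t : ⨁ i, R.term i}
    (ht : t ∈ supportedBelow (S := S) R.term (k + 2)) : d t k = R.d k (t (k + 1)) := by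
  refine eqOn_supportedBelow (f := component S ℕ R.term k ∘ₗ d)
    (g := R.d k ∘ₗ component S ℕ R.term (k + 1)) (fun i hi x => ?_) ht
  rcases Nat.lt_succ_iff_lt_or_eq.1 hi with hi | rfl
  · refine (hp.flag i x k (by omega)).trans ?_
    have : lof S ℕ R.term i x (k + 1) = 0 := lof_mem_supportedBelow hi x _ le_rfl
    exact ((congrArg (R.d k) this).trans (map_zero _)).symm
  · refine (hp.leading k hk x).trans (congrArg (R.d k) ?_)
    exact (lof_apply S _ x).symm

/-- Induction on the top index. The top component of `t` is a cycle of the resolution or, in index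
`0`, is killed by `η` because `ε t` bounds; exactness lifts it, and subtracting `d` of the lift
lowers the support. The bound `n ≤ N` ensures that `d` has the right leading terms where this is
used. -/
theorem exists_boundary (hη : Function.Exact (R.d 0) η) {n : ℕ} (hn : n ≤ N)
    {t : ⨁ i, R.term i} (ht : t ∈ supportedBelow (S := S) R.term n) (hd : d t = 0)
    (hε : ∃ w, D.d w = ε t) : ∃ v ∈ supportedBelow (S := S) R.term (n + 1), d v = t := by
  induction n generalizing t with
  | zero => exact ⟨0, zero_mem _, by rw [map_zero, supportedBelow_zero ht]⟩
  | succ n ih =>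
    have hv : ∃ v, R.d n v = t n := by
      cases n with
      | zero =>
        refine (hη _).1 ?_
        obtain ⟨w, hw⟩ := hε
        have h0 : t - lof S ℕ R.term 0 (t 0) ∈ supportedBelow (S := S) R.term 0 :=
          sub_mem_supportedBelow ht (lof_mem_supportedBelow Nat.zero_lt_one _)
            (lof_apply S _ _).symm
        obtain ⟨hz, h⟩ := hp.lifts (t 0)
        rw [← h]
        refine (Submodule.Quotient.mk_eq_zero _).2 ⟨w, ?_⟩
        rw [hw]
        exact congrArg ε (sub_eq_zero.1 (supportedBelow_zero h0))
      | succ k =>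
        refine (R.exact_succ k _).1 ?_
        rw [← hp.map_apply (by omega) ht, hd]
        rfl
    obtain ⟨v, hv⟩ := hv
    obtain ⟨w, hw⟩ := hε
    obtain ⟨v', hv', hdv'⟩ := ih (by omega)
      (sub_mem_supportedBelow ht (hp.flag (n + 1) v) ((hp.leading n (by omega) v).trans hv).symm)
      (by rw [map_sub, hd, hp.d_d, sub_zero])
      ⟨w - ε (lof S ℕ R.term (n + 1) v), by rw [map_sub, map_sub, hp.comm, hw]⟩
    exact ⟨v' + lof S ℕ R.term (n + 1) v, add_mem (supportedBelow_mono (Nat.le_succ _) hv')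
      (lof_mem_supportedBelow (S := S) (P := R.term) (i := n + 1) (by omega) v), by rw [map_add, hdv', sub_add_cancel]⟩

/-- Let `y` be `R.d N x` placed in `P N`. For `N = k + 1`, `d y` loses its leading term because `R.d
k ∘ R.d (k + 1) = 0`, so `exists_boundary` gives a lower `v` with `d v = d y`. The cycle `y - v` may
have nonzero class in `H(D)`; as `η` is surjective, an element of `P 0` cancels it. For `N = 0`
exactness at `P 0` suffices. -/
theorem exists_correction (hη : Function.Exact (R.d 0) η) (hs : Function.Surjective η)
    (x : R.P (N + 1)) : ∃ t ∈ supportedBelow (S := S) R.term N, ∃ w,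
      d (lof S ℕ R.term N (R.d N x) + t) = 0 ∧ ε (lof S ℕ R.term N (R.d N x) + t) = D.d w := by
  rcases N with _ | k
  · refine ⟨0, zero_mem _, ?_⟩
    rw [add_zero]
    obtain ⟨hz, h⟩ := hp.lifts (R.d 0 x)
    rw [(hη _).2 ⟨x, rfl⟩] at h
    obtain ⟨w, hw⟩ := (Submodule.Quotient.mk_eq_zero _).1 h
    exact ⟨w, supportedBelow_zero (hp.flag 0 _), hw.symm⟩
  · set y := lof S ℕ R.term (k + 1) (R.d (k + 1) x) with hy
    have hdy : d y ∈ supportedBelow (S := S) R.term k := by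
      have := sub_mem_supportedBelow (t := 0) (hp.flag (k + 1) (R.d (k + 1) x)) (zero_mem _) (by
        rw [hp.leading k (Nat.lt_succ_self k)]
        exact (R.exact_succ k _).2 ⟨x, rfl⟩)
      rwa [sub_zero] at this
    obtain ⟨v, hv, hdv⟩ := hp.exists_boundary hη (Nat.le_succ k) hdy (hp.d_d _)
      ⟨ε y, (hp.comm y).symm⟩
    have hcyc : D.d (ε (y - v)) = 0 := by rw [← hp.comm, map_sub, hdv, sub_self, map_zero]
    obtain ⟨p, hpv⟩ := hs (Submodule.Quotient.mk ⟨ε (y - v), hcyc⟩ : D.H)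
    obtain ⟨hz, h⟩ := hp.lifts p
    obtain ⟨w, hw⟩ := (Submodule.Quotient.eq _).1 (hpv.symm.trans h.symm)
    refine ⟨-v - lof S ℕ R.term 0 p, sub_mem (neg_mem hv)
      (lof_mem_supportedBelow (S := S) (P := R.term) (i := 0) (by omega) p), w, ?_, ?_⟩
    · have h0 : d (lof S ℕ R.term 0 p) = 0 := supportedBelow_zero (hp.flag 0 p)
      rw [map_add, map_sub, map_neg, h0, hdv]
      abel
    · have hw' : D.d w = ε (y - v) - ε (lof S ℕ R.term 0 p) := hw
      rw [hw', ← map_sub]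
      congr 1
      abel

/-- Projecting an arbitrary correction to the required degree keeps all its properties, since `d`,
`ε` and `D.d` are homogeneous and the leading term already has that degree. -/
theorem exists_homogeneous_correction (hη : Function.Exact (R.d 0) η)
    (hs : Function.Surjective η) (e : Fin (R.rank (N + 1))) :
    ∃ t ∈ supportedBelow (S := S) R.term N, ∃ w ∈ D.deg (R.shift (N + 1) e - a * ↑(N + 1)),
      lof S ℕ R.term N (R.d N (R.basis (N + 1) e)) + t ∈
        (R.total a).deg (R.shift (N + 1) e - a * ↑(N + 1) + a) ∧
      d (lof S ℕ R.term N (R.d N (R.basis (N + 1) e)) + t) = 0 ∧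
      ε (lof S ℕ R.term N (R.d N (R.basis (N + 1) e)) + t) = D.d w := by
  obtain ⟨t, ht, w, h1, h2⟩ := hp.exists_correction hη hs (R.basis (N + 1) e)
  set s := R.shift (N + 1) e - a * ↑(N + 1) with hsdef
  set y := lof S ℕ R.term N (R.d N (R.basis (N + 1) e)) with hydef
  have hy : y ∈ (R.total a).deg (s + a) := by
    refine lof_mem_total_deg ?_
    have : s + a + a * N = R.shift (N + 1) e := by rw [hsdef]; push_cast; ring
    rw [this]
    exact R.d_mem _ _ _ (R.basis_mem _ e)
  have hproj : y + (R.total a).proj (s + a) t = (R.total a).proj (s + a) (y + t) := by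
    rw [map_add, proj_same (M := R.total a) hy]
  refine ⟨(R.total a).proj (s + a) t, proj_mem_supportedBelow ht _, D.proj s w, D.proj_mem _ _,
    ?_, ?_, ?_⟩
  · rw [hproj]
    exact (R.total a).proj_mem _ _
  · rw [hproj, map_proj (M := R.total a) (N := R.total a) d hp.d_mem, h1, map_zero]
  · rw [hproj, map_proj (M := R.total a) (N := D.toGrMod) (a := 0) ε
      (by simpa using hp.aug_mem), add_zero, h2,
      map_proj (M := D.toGrMod) (N := D.toGrMod) (a := a) D.d (fun _ _ h => D.d_mem h)]

end IsPartialFlag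

end GrMod.MinFreeRes

end PartialFlags

/-! ### The flag resolution, its minimality and the comparison of Betti numbers -/

section Flags

open DirectSum

variable {S : Type u} [CommRing S] {𝒮 : ℕ → AddSubgroup S} [GradedRing 𝒮] [IsLocalRing (𝒮 0)]
  {M : GrMod 𝒮}

namespace GrMod.MinFreeRes

variable {R : M.MinFreeRes} {a : ℤ} {D : DM 𝒮 a}
  {η : R.P 0 →ₗ[S] D.homology}

/-- The start of the recursion has zero differential; `ε` sends the basis of `P 0` to homogeneous
cycles representing its image under `η`. -/
theorem exists_isPartialFlag_zero (R : M.MinFreeRes) (D : DM 𝒮 a) (η : R.P 0 →ₗ[S] D.homology)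
    (hη : ∀ j x, x ∈ (R.P 0).deg j → η x ∈ D.homology.deg j) :
    ∃ ε, IsPartialFlag R D η 0 0 ε ∧ ∀ i > 0, ∀ x, ε (lof S ℕ R.term i x) = 0 := by
  have hz : ∀ e, ∃ z : LinearMap.ker D.d, (z : D) ∈ D.deg (R.shift 0 e) ∧
      (Submodule.Quotient.mk z : D.H) = η (R.basis 0 e) := fun e =>
    (D.mem_homologyDeg _ _).1 (hη _ _ (R.basis_mem 0 e))
  choose z hzdeg hzη using hz
  let f : R.term 0 →ₗ[S] LinearMap.ker D.d := (R.basis 0).constr ℕ z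
  have hf : ∀ e, f (R.basis 0 e) = z e := fun e => (R.basis 0).constr_basis ℕ z e
  have hmk : ∀ x, (Submodule.Quotient.mk (f x) : D.H) = η x := by
    have : Submodule.mkQ ((LinearMap.range D.d).submoduleOf (LinearMap.ker D.d)) ∘ₗ f = η :=
      (R.basis 0).ext fun e => by
        rw [LinearMap.comp_apply, hf]
        exact hzη e
    exact fun x => LinearMap.congr_fun this x
  let ε : (⨁ i, R.term i) →ₗ[S] D :=
    (LinearMap.ker D.d).subtype ∘ₗ f ∘ₗ component S ℕ R.term 0
  have hε0 : ∀ x, ε (lof S ℕ R.term 0 x) = f x := fun x =>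
    congrArg (fun y => (f y : D)) (lof_apply S 0 x)
  have hε : ∀ i > 0, ∀ x, ε (lof S ℕ R.term i x) = 0 := by
    intro i hi x
    have : lof S ℕ R.term i x 0 = 0 := by
      rw [lof_eq_of, of_eq_of_ne _ _ _ hi.ne]
    exact (congrArg (fun y => (f y : D)) this).trans (by rw [map_zero]; rfl)
  refine ⟨ε, ⟨fun i x => zero_mem _, fun i hi => absurd hi (Nat.not_lt_zero i), fun _ => rfl,
    fun t => ?_, fun _ _ _ => zero_mem _, fun j t ht => ?_, fun x => ?_⟩, hε⟩
  · rw [LinearMap.zero_apply, map_zero]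
    exact (LinearMap.mem_ker.1 (f (t 0)).2).symm
  · have := map_mem_of_basis (M := R.total a) (N := D.toGrMod) (a := 0) R.totalBasis
      totalBasis_mem ε (fun p => ?_) ht
    · rwa [add_zero] at this
    · obtain ⟨i, e⟩ := p
      rw [totalBasis_apply]
      rcases Nat.eq_zero_or_pos i with rfl | hi
      · rw [hε0, hf]
        simpa using hzdeg e
      · rw [hε i hi]
        exact zero_mem _
  · refine ⟨?_, ?_⟩
    · rw [hε0]
      exact (f x).2
    · rw [← hmk]
      exact congrArg _ (Subtype.ext (hε0 x))

/-- The corrected leading terms prescribe `d` on the basis of `P (N + 1)`, and the bounding elements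
`w` prescribe `ε`. As the old maps vanish there, adding the new ones through the component map gives
exactly the prescribed values. -/
theorem IsPartialFlag.exists_succ {N : ℕ} {d : (⨁ i, R.term i) →ₗ[S] ⨁ i, R.term i}
    {ε : (⨁ i, R.term i) →ₗ[S] D} (hp : IsPartialFlag R D η N d ε)
    (hd0 : ∀ i > N, ∀ x, d (lof S ℕ R.term i x) = 0)
    (hε0 : ∀ i > N, ∀ x, ε (lof S ℕ R.term i x) = 0)
    (hη : Function.Exact (R.d 0) η) (hs : Function.Surjective η) :
    ∃ d' ε', IsPartialFlag R D η (N + 1) d' ε' ∧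
      (∀ i > N + 1, ∀ x, d' (lof S ℕ R.term i x) = 0) ∧
      (∀ i > N + 1, ∀ x, ε' (lof S ℕ R.term i x) = 0) ∧
      (∀ i ≤ N, ∀ x, d' (lof S ℕ R.term i x) = d (lof S ℕ R.term i x)) ∧
      ∀ i ≤ N, ∀ x, ε' (lof S ℕ R.term i x) = ε (lof S ℕ R.term i x) := by
  choose t ht w hw hdeg hcyc hbd using hp.exists_homogeneous_correction hη hs
  let δ : R.term (N + 1) →ₗ[S] ⨁ i, R.term i := (R.basis (N + 1)).constr ℕ
    fun e => lof S ℕ R.term N (R.d N (R.basis (N + 1) e)) + t e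
  let ω : R.term (N + 1) →ₗ[S] D := (R.basis (N + 1)).constr ℕ w
  have hδ : ∀ e, δ (R.basis (N + 1) e) = lof S ℕ R.term N (R.d N (R.basis (N + 1) e)) + t e :=
    fun e => (R.basis (N + 1)).constr_basis ℕ _ e
  have hω : ∀ e, ω (R.basis (N + 1) e) = w e := fun e => (R.basis (N + 1)).constr_basis ℕ _ e
  let d' := d + δ ∘ₗ component S ℕ R.term (N + 1)
  let ε' := ε + ω ∘ₗ component S ℕ R.term (N + 1)
  have hcomp : ∀ i, i ≠ N + 1 → ∀ x, component S ℕ R.term (N + 1) (lof S ℕ R.term i x) = 0 := by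
    intro i hi x
    change lof S ℕ R.term i x (N + 1) = 0
    rw [lof_eq_of, of_eq_of_ne _ _ _ hi.symm]
  have hcompN : ∀ x, component S ℕ R.term (N + 1) (lof S ℕ R.term (N + 1) x) = x := fun x =>
    lof_apply S _ x
  have hd' : ∀ i, i ≠ N + 1 → ∀ x, d' (lof S ℕ R.term i x) = d (lof S ℕ R.term i x) := by
    intro i hi x
    rw [LinearMap.add_apply, LinearMap.comp_apply, hcomp i hi, map_zero, add_zero]
  have hε' : ∀ i, i ≠ N + 1 → ∀ x, ε' (lof S ℕ R.term i x) = ε (lof S ℕ R.term i x) := by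
    intro i hi x
    rw [LinearMap.add_apply, LinearMap.comp_apply, hcomp i hi, map_zero, add_zero]
  have hd'N : ∀ x, d' (lof S ℕ R.term (N + 1) x) = δ x := by
    intro x
    rw [LinearMap.add_apply, LinearMap.comp_apply, hcompN, hd0 _ (Nat.lt_succ_self N), zero_add]
  have hε'N : ∀ x, ε' (lof S ℕ R.term (N + 1) x) = ω x := by
    intro x
    rw [LinearMap.add_apply, LinearMap.comp_apply, hcompN, hε0 _ (Nat.lt_succ_self N), zero_add]
  have hd'low : ∀ s ∈ supportedBelow (S := S) R.term (N + 1), d' s = d s := fun s hs =>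
    eqOn_supportedBelow (fun i hi x => hd' i hi.ne x) hs
  have hε'low : ∀ s ∈ supportedBelow (S := S) R.term (N + 1), ε' s = ε s := fun s hs =>
    eqOn_supportedBelow (fun i hi x => hε' i hi.ne x) hs
  have hδlow : ∀ x, δ x ∈ supportedBelow (S := S) R.term (N + 1) := by
    intro x
    induction x using basis_induction (R.basis (N + 1)) with
    | h0 => rw [map_zero]; exact zero_mem _
    | hadd x y hx hy => rw [map_add]; exact add_mem hx hy
    | hsmul c e =>
      rw [map_smul, hδ]
      exact Submodule.smul_mem _ _ (add_mem (lof_mem_supportedBelow (Nat.lt_succ_self N) _)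
        (supportedBelow_mono (Nat.le_succ N) (ht e)))
  have hlow : ∀ i, i ≠ N + 1 → ∀ x,
      d (lof S ℕ R.term i x) ∈ supportedBelow (S := S) R.term (N + 1) := by
    intro i hi x
    rcases lt_or_gt_of_ne hi with hi | hi
    · exact supportedBelow_mono hi.le (hp.flag i x)
    · rw [hd0 i (by omega)]
      exact zero_mem _
  have hδcyc : d ∘ₗ δ = 0 := (R.basis (N + 1)).ext fun e => by
    rw [LinearMap.comp_apply, hδ, hcyc]
    rfl
  have hδbd : ε ∘ₗ δ = D.d ∘ₗ ω := (R.basis (N + 1)).ext fun e => by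
    rw [LinearMap.comp_apply, LinearMap.comp_apply, hδ, hbd, hω]
  have hδlead : component S ℕ R.term N ∘ₗ δ = R.d N := (R.basis (N + 1)).ext fun e => by
    rw [LinearMap.comp_apply, hδ, map_add, ← apply_eq_component, ← apply_eq_component, ht e N le_rfl,
      add_zero, lof_apply]
  refine ⟨d', ε', ⟨fun i x => ?_, fun i hi x => ?_, fun s => ?_, fun s => ?_, fun j s hs => ?_,
    fun j s hs => ?_, fun x => ?_⟩, fun i hi x => ?_, fun i hi x => ?_, fun i hi => hd' i (by omega),
    fun i hi => hε' i (by omega)⟩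
  · by_cases hi : i = N + 1
    · subst hi
      rw [hd'N]
      exact hδlow x
    · rw [hd' i hi]
      exact hp.flag i x
  · rcases Nat.lt_succ_iff_lt_or_eq.1 hi with hi | rfl
    · rw [hd' _ (by omega)]
      exact hp.leading i hi x
    · rw [hd'N]
      exact LinearMap.congr_fun hδlead x
  · refine LinearMap.congr_fun (f := d' ∘ₗ d') (g := 0) (linearMap_ext _ fun i => ?_) s
    refine LinearMap.ext fun x => ?_
    simp only [LinearMap.comp_apply]
    by_cases hi : i = N + 1
    · subst hi
      rw [hd'N, hd'low _ (hδlow x)]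
      exact LinearMap.congr_fun hδcyc x
    · rw [hd' i hi, hd'low _ (hlow i hi x), hp.d_d]
      rfl
  · refine LinearMap.congr_fun (f := ε' ∘ₗ d') (g := D.d ∘ₗ ε') (linearMap_ext _ fun i => ?_) s
    refine LinearMap.ext fun x => ?_
    simp only [LinearMap.comp_apply]
    by_cases hi : i = N + 1
    · subst hi
      rw [hd'N, hε'N, hε'low _ (hδlow x)]
      exact LinearMap.congr_fun hδbd x
    · rw [hd' i hi, hε' i hi, hε'low _ (hlow i hi x), hp.comm]
  · refine map_mem_of_basis (M := R.total a) (N := R.total a) R.totalBasis totalBasis_mem d'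
      (fun ⟨i, e⟩ => ?_) hs
    by_cases hi : i = N + 1
    · subst hi
      rw [totalBasis_apply, hd'N, hδ]
      exact hdeg e
    · have := hp.d_mem _ _ (totalBasis_mem ⟨i, e⟩)
      rw [totalBasis_apply] at this ⊢
      rwa [hd' i hi]
  · have := map_mem_of_basis (M := R.total a) (N := D.toGrMod) (a := 0) R.totalBasis
      totalBasis_mem ε' (fun ⟨i, e⟩ => ?_) hs
    · rwa [add_zero] at this
    rw [add_zero]
    by_cases hi : i = N + 1
    · subst hi
      rw [totalBasis_apply, hε'N, hω]
      exact hw e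
    · have := hp.aug_mem _ _ (totalBasis_mem ⟨i, e⟩)
      rw [totalBasis_apply] at this ⊢
      rwa [hε' i hi]
  · have h := hp.lifts x
    rwa [← hε' 0 (by omega)] at h
  · rw [hd' i (by omega), hd0 i (by omega)]
  · rw [hε' i (by omega), hε0 i (by omega)]

/-- The stages stabilise on each summand, and each element has finite support, so every condition on
the limit is inherited from some finite stage. -/
theorem exists_flag (R : M.MinFreeRes) (D : DM 𝒮 a) (η : R.P 0 →ₗ[S] D.homology)
    (hdeg : ∀ j x, x ∈ (R.P 0).deg j → η x ∈ D.homology.deg j)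
    (hη : Function.Exact (R.d 0) η) (hs : Function.Surjective η) :
    ∃ d ε, ∀ N, IsPartialFlag R D η N d ε := by
  obtain ⟨ε₀, h₀, h₀'⟩ := exists_isPartialFlag_zero R D η hdeg
  let St (N : ℕ) := {p : ((⨁ i, R.term i) →ₗ[S] ⨁ i, R.term i) × ((⨁ i, R.term i) →ₗ[S] D) //
    IsPartialFlag R D η N p.1 p.2 ∧ (∀ i > N, ∀ x, p.1 (lof S ℕ R.term i x) = 0) ∧
      ∀ i > N, ∀ x, p.2 (lof S ℕ R.term i x) = 0}
  have step : ∀ N (p : St N), ∃ p' : St (N + 1),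
      (∀ i ≤ N, ∀ x, p'.1.1 (lof S ℕ R.term i x) = p.1.1 (lof S ℕ R.term i x)) ∧
      ∀ i ≤ N, ∀ x, p'.1.2 (lof S ℕ R.term i x) = p.1.2 (lof S ℕ R.term i x) := by
    rintro N ⟨⟨d, ε⟩, hp, hd0, hε0⟩
    obtain ⟨d', ε', hp', hd0', hε0', hd, hε⟩ := hp.exists_succ hd0 hε0 hη hs
    exact ⟨⟨⟨d', ε'⟩, hp', hd0', hε0'⟩, hd, hε⟩
  let T : ∀ N, St N := fun N =>
    Nat.rec ⟨⟨0, ε₀⟩, h₀, fun _ _ _ => rfl, h₀'⟩ (fun N p => (step N p).choose) N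
  obtain ⟨d, hd⟩ := exists_limit (fun N => (T N).1.1) fun N => (step N (T N)).choose_spec.1
  obtain ⟨ε, hε⟩ := exists_limit (fun N => (T N).1.2) fun N => (step N (T N)).choose_spec.2
  have hT : ∀ N, IsPartialFlag R D η N (T N).1.1 (T N).1.2 := fun N => (T N).2.1
  have hlof : ∀ i x, lof S ℕ R.term i x ∈ supportedBelow (S := S) R.term (i + 1) := fun i x =>
    lof_mem_supportedBelow (Nat.lt_succ_self i) x
  refine ⟨d, ε, fun N => ⟨fun i x => ?_, fun i _ x => ?_, fun t => ?_, fun t => ?_,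
    fun j t ht => ?_, fun j t ht => ?_, fun x => ?_⟩⟩
  · rw [hd i _ (hlof i x)]
    exact (hT i).flag i x
  · rw [hd (i + 1) _ (hlof (i + 1) x)]
    exact (hT (i + 1)).leading i (Nat.lt_succ_self i) x
  · obtain ⟨n, hn⟩ := exists_mem_supportedBelow (S := S) t
    rw [hd n t (supportedBelow_mono (Nat.le_succ n) hn), hd n _ (supportedBelow_mono (Nat.le_succ n)
      ((hT n).map_mem_supportedBelow (supportedBelow_mono (Nat.le_succ n) hn))), (hT n).d_d]
  · obtain ⟨n, hn⟩ := exists_mem_supportedBelow (S := S) t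
    rw [hd n t (supportedBelow_mono (Nat.le_succ n) hn), hε n t
      (supportedBelow_mono (Nat.le_succ n) hn), hε n _ (supportedBelow_mono (Nat.le_succ n)
      ((hT n).map_mem_supportedBelow (supportedBelow_mono (Nat.le_succ n) hn))), (hT n).comm]
  · obtain ⟨n, hn⟩ := exists_mem_supportedBelow (S := S) t
    rw [hd n t (supportedBelow_mono (Nat.le_succ n) hn)]
    exact (hT n).d_mem j t ht
  · obtain ⟨n, hn⟩ := exists_mem_supportedBelow (S := S) t
    rw [hε n t (supportedBelow_mono (Nat.le_succ n) hn)]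
    exact (hT n).aug_mem j t ht
  · have h := (hT 0).lifts x
    rwa [← hε 0 _ (hlof 0 x)] at h

theorem algebraMap_repr_leading (R : M.MinFreeRes) (i : ℕ) (e : Fin (R.rank (i + 1))) (e' : Fin (R.rank i)) :
    algebraMap S (ResField 𝒮) ((R.basis i).repr (R.d i (R.basis (i + 1) e)) e') = 0 := by
  have h := congrArg (fun f => ((R.basis i).baseChange (ResField 𝒮)).repr
    (f (1 ⊗ₜ[S] R.basis (i + 1) e)) e') (R.minimal i)
  simpa [Algebra.smul_def] using h

section Flag

variable {d : (⨁ i, R.term i) →ₗ[S] ⨁ i, R.term i} {ε : (⨁ i, R.term i) →ₗ[S] D}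
  (hp : ∀ N, IsPartialFlag R D η N d ε)

include hp

/-- Injectivity on homology is `exists_boundary` without restriction on the support; surjectivity
already holds on `P 0`, where `d` is zero. -/
theorem isQuis_of_flag (hη : Function.Exact (R.d 0) η) (hs : Function.Surjective η) :
    IsQuis d D.d ε where
  comm := (hp 0).comm
  inj t ht hε := by
    obtain ⟨n, hn⟩ := exists_mem_supportedBelow (S := S) t
    obtain ⟨v, -, hv⟩ := (hp n).exists_boundary hη le_rfl hn ht hε
    exact ⟨v, hv⟩
  surj y hy := by
    obtain ⟨p, hpy⟩ := hs (Submodule.Quotient.mk ⟨y, hy⟩ : D.H)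
    obtain ⟨hz, h⟩ := (hp 0).lifts p
    obtain ⟨w, hw⟩ := (Submodule.Quotient.eq _).1 (hpy.symm.trans h.symm)
    refine ⟨lof S ℕ R.term 0 p, w, supportedBelow_zero ((hp 0).flag 0 p), ?_⟩
    have hw' : D.d w = y - ε (lof S ℕ R.term 0 p) := hw
    rw [hw', add_sub_cancel]

theorem isHomotopyProjective_of_flag : IsHomotopyProjective d :=
  have : ∀ i, Module.Projective S (R.term i) := fun i => Module.Projective.of_basis (R.basis i)
  isHomotopyProjective_directSum d (hp 0).d_d (hp 0).flag

/-- An entry of `d` from `P i` to `P m` survives over `𝕜` only in degree zero. It is zero for `m ≥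
i` by the flag condition, dies for `i = m + 1` by minimality of `R`, and for larger gaps degree zero
is what `hline` forbids. -/
theorem minimal_of_flag
    (hline : ∀ (c j : ℕ), 2 ≤ j → ∀ (e : Fin (R.rank (c + j))) (e' : Fin (R.rank c)),
      R.shift (c + j) e - R.shift c e' ≠ a * (j - 1)) :
    d.baseChange (ResField 𝒮) = 0 := by
  refine (R.totalBasis.baseChange (ResField 𝒮)).ext fun ⟨i, e⟩ => ?_
  rw [Module.Basis.baseChange_apply, LinearMap.baseChange_tmul, LinearMap.zero_apply]
  refine (R.totalBasis.baseChange (ResField 𝒮)).repr.injective (Finsupp.ext fun ⟨m, e'⟩ => ?_)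
  rw [map_zero, Module.Basis.baseChange_repr_tmul, Finsupp.zero_apply, Algebra.smul_def, mul_one]
  by_cases h : R.shift i e - a * i + a = R.shift m e' - a * m
  · rw [totalBasis_apply, totalBasis_repr]
    by_cases hmi : m < i
    · obtain ⟨j, rfl⟩ := Nat.exists_eq_add_of_lt hmi
      cases j with
      | zero =>
        rw [(hp (m + 1)).leading m (Nat.lt_succ_self m), algebraMap_repr_leading]
      | succ j =>
        have key : R.shift (m + (j + 1) + 1) e - R.shift m e' = a * (((j + 1 + 1 : ℕ) : ℤ) - 1) := by
          push_cast at h ⊢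
          linarith
        exact absurd key (hline m (j + 1 + 1) (by omega) e e')
    · rw [(hp 0).flag i _ m (not_lt.1 hmi), map_zero, Finsupp.zero_apply, map_zero]
  · exact algebraMap_repr_eq_zero (M := R.total a) R.totalBasis totalBasis_mem
      ((hp 0).d_mem _ _ (totalBasis_mem ⟨i, e⟩)) h

end Flag

/-- The point is that the right-hand side does not involve `D`: all differential modules of degree
`a` with homology `M` get the same number. -/
theorem hasTotalBetti_eq_rank (R : M.MinFreeRes)
    (hline : ∀ (c j : ℕ), 2 ≤ j → ∀ (e : Fin (R.rank (c + j))) (e' : Fin (R.rank c)),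
      R.shift (c + j) e - R.shift c e' ≠ a * (j - 1))
    (hM : D.homology.Isom M) {c : Cardinal.{u}} (hc : D.HasTotalBetti c) :
    c = Module.rank (ResField 𝒮) (ResField 𝒮 ⊗[S] ⨁ i, R.term i) := by
  obtain ⟨φ, hφ⟩ := hM
  let η : R.P 0 →ₗ[S] D.homology := φ.symm.toLinearMap ∘ₗ R.aug
  have hs : Function.Surjective η := φ.symm.surjective.comp R.aug_surjective
  have hη : Function.Exact (R.d 0) η := fun x => by
    rw [← R.exact_zero x]
    exact φ.symm.map_eq_zero_iff
  obtain ⟨d, ε, hp⟩ := exists_flag R D η (fun j x hx => by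
    rw [hφ]
    change φ (φ.symm (R.aug x)) ∈ M.deg j
    rw [φ.apply_symm_apply]
    exact R.aug_mem j x hx) hη hs
  exact hc.eq_rank (hp 0).d_d (isHomotopyProjective_of_flag hp) (minimal_of_flag hp hline)
    (isQuis_of_flag hp hη hs)

end GrMod.MinFreeRes

/-- A graded module is the homology of the corresponding differential module. -/
theorem GrMod.toDM_homology_isom {N M : GrMod 𝒮} (a : ℤ) (h : N.Isom M) :
    (N.toDM a).homology.Isom M := by
  obtain ⟨φ, hφ⟩ := h
  let f : N →ₗ[S] (N.toDM a).H := Submodule.mkQ _ ∘ₗ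
    LinearMap.id.codRestrict (LinearMap.ker (N.toDM a).d) fun _ => rfl
  have hbij : Function.Bijective f := by
    constructor
    · rw [injective_iff_map_eq_zero]
      intro x hx
      obtain ⟨y, hy⟩ := (Submodule.Quotient.mk_eq_zero _).1 hx
      exact hy.symm
    · intro y
      obtain ⟨⟨x, hx⟩, rfl⟩ := Submodule.Quotient.mk_surjective _ y
      exact ⟨x, rfl⟩
  let e := LinearEquiv.ofBijective f hbij
  refine ⟨e.symm.trans φ, fun j x => ?_⟩
  obtain ⟨y, rfl⟩ := e.surjective x
  have hy : (e.symm.trans φ) (e y) = φ y := congrArg φ (e.symm_apply_apply y)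
  refine Iff.trans ?_ ((hφ j y).trans (iff_of_eq (congrArg (· ∈ M.deg j) hy.symm)))
  constructor
  · rintro ⟨⟨z, _⟩, hz, hzy⟩
    have : e z = e y := hzy
    rw [← e.injective this]
    exact hz
  · exact fun hy => ⟨⟨y, rfl⟩, hy, rfl⟩

theorem GrMod.betti_ne_zero (h : Nonempty M.MinFreeRes) {i : ℕ} (e : Fin (h.some.rank i)) :
    M.betti i (h.some.shift i e) ≠ 0 := by
  rw [GrMod.betti, dif_pos h]
  have : Nonempty {e' // h.some.shift i e' = h.some.shift i e} := ⟨⟨e, rfl⟩⟩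
  exact Nat.card_pos.ne'

end Flags

end DiffMod

end

/-! ### The main theorem -/

theorem mainTheorem8 {S : Type u} [CommRing S] [IsNoetherianRing S]
    (𝒮 : ℕ → AddSubgroup S) [GradedRing 𝒮] [IsLocalRing (𝒮 0)]
    (M : DiffMod.GrMod 𝒮) (hfg : Module.Finite S M)
    (hpd : CategoryTheory.projectiveDimension (ModuleCat.of S M) ≠ ⊤)
    (a : ℤ)
    (hD : ∃ D : DiffMod.DM 𝒮 a, D.IsBettiDeficient ∧ D.homology.Isom M) :
    ∃ (c₁ c₂ : ℕ) (r₁ r₂ : ℤ) (j : ℕ), 2 ≤ j ∧ c₂ = c₁ + j ∧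
      M.bettiTable c₁ r₁ ≠ 0 ∧ M.bettiTable c₂ r₂ ≠ 0 ∧
      ((r₁ : ℚ) - r₂) / ((c₂ : ℚ) - c₁) = 1 - a + a / j := by
  obtain ⟨D, ⟨c, c', hc, hc', hlt⟩, hM⟩ := hD
  have hR : Nonempty M.MinFreeRes := M.nonempty_minFreeRes hfg
  by_contra hno
  -- The chosen resolution `hR.some` is the one by which `betti` is defined, so no uniqueness of
  -- minimal resolutions is needed.
  have hline : ∀ (c j : ℕ), 2 ≤ j → ∀ (e : Fin (hR.some.rank (c + j))) (e' : Fin (hR.some.rank c)),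
      hR.some.shift (c + j) e - hR.some.shift c e' ≠ a * (j - 1) := by
    intro c j hj e e' h
    -- A shift `k` in column `c` sits in row `k - c`. Hence `r₁ - r₂ = j - a * (j - 1)`, and
    -- division by `j` gives `1 - a + a / j`.
    refine hno ⟨c, c + j, hR.some.shift c e' - c, hR.some.shift (c + j) e - ↑(c + j), j, hj, rfl,
      ?_, ?_, ?_⟩
    · rw [DiffMod.GrMod.bettiTable, sub_add_cancel]
      exact DiffMod.GrMod.betti_ne_zero hR e'
    · rw [DiffMod.GrMod.bettiTable, sub_add_cancel]
      exact DiffMod.GrMod.betti_ne_zero hR e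
    · have hj0 : (j : ℚ) ≠ 0 := by
        have : j ≠ 0 := by omega
        exact_mod_cast this
      have hq : (hR.some.shift (c + j) e : ℚ) - hR.some.shift c e' = a * (j - 1) := by
        exact_mod_cast h
      push_cast
      rw [add_sub_cancel_left]
      field_simp
      linarith
  have h1 := hR.some.hasTotalBetti_eq_rank hline hM hc
  -- The same resolution serves `H(D)` with zero differential, whose homology is again `M`.
  have h2 := hR.some.hasTotalBetti_eq_rank hline
    (DiffMod.GrMod.toDM_homology_isom a hM) hc'
  exact hlt.ne (h1.trans h2.symm)
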